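/- **Setup.** Let $p$ be a prime, $q=p$ if $p>2$ and $q=4$ if $p=2$, and $\Delta=(\mathbb Z/q\mathbb Z)^\times$. Let $\Lambda=\mathbb Z_p[[\mathbb Z_p^\times]]\cong\mathbb Z_p[\Delta]\otimes_{\mathbb Z_p}\mathbb Z_p[[T]]$ be the Iwasawa algebra, where $T=[\exp(q)]-1$, and let $[-]:\mathbb Z_p^\times\to\Lambda^\times$ be the universal character, so that $[a]=[a\bmod q]\,(1+T)^{\log\langle a\rangle/q}$, with $\langle a\rangle\in 1+q\mathbb Z_p$ the quotient of $a$ by the root of unity $\omega$ with $\omega^{\varphi(q)}=1$ and $\omega\equiv a \bmod q$. Put $\mathfrak m_\Lambda=(p,T)$; $\Lambda$ and $\Lambda[[X]]$ carry the $\mathfrak m_\Lambda$-adic topology. Put $\Lambda^{>1/p}=\Lambda[[pT^{-1}]]=\Lambda[[Y]]/(TY-p)$. Let $D$ be a definite quaternion algebra over $\mathbb Q$ with a fixed isomorphism $D\otimes\mathbb Q_p\cong \mathrm M_2(\mathbb Q_p)$, and let $\mathrm{Iw}_q\subset\mathrm{GL}_2(\mathbb Z_p)$ be the subgroup of matrices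 whose lower left entry is divisible by $q$. Let $K^p$ be an open compact subgroup of $(D\otimes\mathbb A_f^{(p)})^\times$ that is neat: $x^{-1}D^\times x\cap K^p\mathrm{Iw}_q=\{1\}$ for all $x\in(D\otimes\mathbb A_f)^\times$. Let $t=\#\,D^\times\backslash(D\otimes\mathbb A_f)^\times/K^p\mathrm{Iw}_q$ and let $\gamma_0,\dots,\gamma_{t-1}$ be representatives of these double cosets whose $p$-components are $1$. For $\delta=\begin{pmatrix}a&b\\c&d\end{pmatrix}\in \mathrm M_2(\mathbb Z_p)$ with $q\mid c$, $p\nmid d$, $\det\delta\ne0$, and $h:\mathbb Z_p\to\Lambda$ continuous, put $(h\|_\delta)(z)=[cz+d]\,h\!\left(\frac{az+b}{cz+d}\right)$. The space $S^D_{\mathrm{int}}$ of integral $p$-adic automorphic forms consists of the functions $\varphi:D^\times\backslash(D\otimes\mathbb A_f)^\times/K^p\to\mathcal C(\mathbb Z_p;\Lambda)$ with $\varphi(xu)=\varphi(x)\|_u$ for all $u\in\mathrm{Iw}_q$, and $$(U_p\varphi)(x)=\sum_{j=0}^{p-1}\varphi(xv_j^{-1})\|_{v_j},\qquad v_j=\begin{pmatrix}p&0\\jq&1\end{pmatrix}.$$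 For $k\ge0$ and $0\le i<t$ let $e_{kt+i}=\binom{z_i}{k}\in S^D_{\mathrm{int}}$ be the form with value $\binom zk$ at $\gamma_i$ and value $0$ at $\gamma_{i'}$ for $i'\neq i$. Let $P=(P_{m,n})_{m,n\ge0}$ be the matrix of $U_p$ in this basis: $U_pe_n=\sum_{m\ge0}P_{m,n}e_m$ with $P_{m,n}\in\Lambda$ and $P_{m,n}\to0$ as $m\to\infty$. **Theorem 3.10.** The forms $e_n$ and the matrix $P$ exist and are uniquely determined. The characteristic power series $$\mathrm{Char}(P)=\lim_{n\to\infty}\det\bigl(I_n-X(P_{i,j})_{0\le i,j<n}\bigr)=\sum_{n\ge0}c_nX^n\in\Lambda[[X]]$$ is well defined: the limit exists in the $\mathfrak m_\Lambda$-adic topology of $\Lambda[[X]]$ and is unique. Moreover, for every $n\ge0$, (the image of) $c_n$ lies in $T^{\lambda(n)}\Lambda^{>1/p}$, where $\lambda(0)=0$ and $$\lambda(i+1)-\lambda(i)=\Big\lfloor\frac it\Big\rfloor-\Big\lfloor\frac i{pt}\Big\rfloor\qquad(i\ge0).$$ -/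

import Mathlib

open scoped TensorProduct RestrictedProduct

noncomputable section

namespace IntegralForms

/-! ### The prime `p`, the number `q` and the `p`-adic logarithm -/

section Padic

variable (p : ℕ) [Fact p.Prime]

/-- The exponent `v(q)`: `2` if `p = 2`, and `1` otherwise. -/
def qExp : ℕ := if p = 2 then 2 else 1

/-- `q = 4` if `p = 2`, and `q = p` otherwise. -/
abbrev q : ℕ := p ^ qExp p

/-- The logarithm series `log x = ∑_{n ≥ 1} (-1)^(n-1) (x - 1)^n / n`, convergent
for `|x - 1| < 1`. -/
def padicLog (x : ℚ_[p]) : ℚ_[p] :=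
  ∑' n : ℕ, (-1) ^ n * (x - 1) ^ (n + 1) / ((n + 1 : ℕ) : ℚ_[p])

variable {p}

lemma norm_log_term (y : ℚ_[p]) (hy : ‖y‖ ≤ (p : ℝ)⁻¹) (n : ℕ) :
    ‖(-1) ^ n * y ^ (n + 1) / ((n + 1 : ℕ) : ℚ_[p])‖ ≤ ‖y‖ := by
  have hp : p.Prime := Fact.out
  have hp0 : (0 : ℝ) < p := by exact_mod_cast hp.pos
  have hn : ((n + 1 : ℕ) : ℚ_[p]) ≠ 0 := by exact_mod_cast Nat.succ_ne_zero n
  have h1 : ((p : ℝ)⁻¹) ^ n ≤ ‖((n + 1 : ℕ) : ℚ_[p])‖ := by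
    have hv : padicValNat p (n + 1) ≤ n := by
      have h2 : p ^ padicValNat p (n + 1) ≤ n + 1 := Nat.le_of_dvd (Nat.succ_pos n) pow_padicValNat_dvd
      have h3 : n + 1 < p ^ (n + 1) := Nat.lt_pow_self hp.one_lt
      have h4 := (Nat.pow_lt_pow_iff_right hp.one_lt).1 (h2.trans_lt h3)
      omega
    rw [Padic.norm_eq_zpow_neg_valuation hn, Padic.valuation_natCast, zpow_neg, zpow_natCast, inv_pow]
    have h5 : (p : ℝ) ^ padicValNat p (n + 1) ≤ (p : ℝ) ^ n :=
      pow_le_pow_right₀ (by exact_mod_cast hp.one_lt.le) hv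
    exact inv_anti₀ (by positivity) h5
  rw [norm_div, norm_mul, norm_pow, norm_neg, norm_one, one_pow, one_mul, norm_pow, pow_succ,
    div_le_iff₀ (norm_pos_iff.2 hn), mul_comm]
  have h6 : ‖y‖ ^ n ≤ ((p : ℝ)⁻¹) ^ n := pow_le_pow_left₀ (norm_nonneg _) hy n
  exact mul_le_mul_of_nonneg_left (h6.trans h1) (norm_nonneg _)

lemma norm_padicLog_le (x : ℚ_[p]) (hx : ‖x - 1‖ ≤ (p : ℝ)⁻¹) : ‖padicLog p x‖ ≤ ‖x - 1‖ :=
  (IsUltrametricDist.norm_tsum_le _).trans (ciSup_le fun n => norm_log_term (x - 1) hx n)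

lemma norm_sub_one_le (a : ℤ_[p]ˣ) :
    ‖((a : ℤ_[p]) : ℚ_[p]) ^ Nat.totient (q p) - 1‖ ≤ ‖(Nat.totient (q p) * q p : ℚ_[p])‖ ∧
    ‖((a : ℤ_[p]) : ℚ_[p]) ^ Nat.totient (q p) - 1‖ ≤ (p : ℝ)⁻¹ := by
  have hp : p.Prime := Fact.out
  have key : ∀ m k : ℕ, ((PadicInt.toZModPow k) (a : ℤ_[p])) ^ m = 1 →
      ‖((a : ℤ_[p]) : ℚ_[p]) ^ m - 1‖ ≤ (p : ℝ) ^ (-k : ℤ) := by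
    intro m k h
    have h1 : (a : ℤ_[p]) ^ m - 1 ∈ RingHom.ker (PadicInt.toZModPow (p := p) k) := by
      rw [RingHom.mem_ker, map_sub, map_pow, h, map_one, sub_self]
    rw [PadicInt.ker_toZModPow, ← PadicInt.norm_le_pow_iff_mem_span_pow] at h1
    simpa [PadicInt.norm_def] using h1
  by_cases h2 : p = 2
  · subst h2
    have hq : q 2 = 4 := by simp [q, qExp]
    have ht : Nat.totient (q 2) = 2 := by rw [hq]; decide
    have h3 := key 2 3 (by
      have hu : ∀ u : (ZMod (2 ^ 3))ˣ, (u : ZMod (2 ^ 3)) ^ 2 = 1 := by decide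
      exact hu (Units.map (PadicInt.toZModPow (p := 2) 3).toMonoidHom a))
    rw [ht]
    refine ⟨h3.trans (le_of_eq ?_), h3.trans ?_⟩
    · have h8 : ((2 : ℕ) * (q 2 : ℕ) : ℚ_[2]) = ((2 : ℕ) : ℚ_[2]) ^ 3 := by rw [hq]; norm_num
      rw [h8, norm_pow, Padic.norm_p]; norm_num
    · norm_num
  · have he : qExp p = 1 := by simp [qExp, h2]
    have hq : q p = p := by simp [q, he]
    have h3 := key (Nat.totient (q p)) 1 (by
      have h4 := congrArg (fun u : (ZMod (p ^ 1))ˣ => (u : ZMod (p ^ 1)))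
        (ZMod.pow_totient (Units.map (PadicInt.toZModPow (p := p) 1).toMonoidHom a))
      have h7 : Nat.totient (q p) = Nat.totient (p ^ 1) := by rw [hq, pow_one]
      rw [h7]
      exact h4)
    have h5 : (p : ℝ) ^ (-(1 : ℕ) : ℤ) = (p : ℝ)⁻¹ := by simp
    rw [h5] at h3
    refine ⟨h3.trans (le_of_eq ?_), h3⟩
    have h6 : ‖((Nat.totient (q p) : ℕ) : ℚ_[p])‖ = 1 := by
      rw [Padic.norm_natCast_eq_one_iff, hq, Nat.totient_prime hp]
      exact (Nat.coprime_self_sub_right hp.one_le).2 (Nat.coprime_one_right p)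
    rw [norm_mul, h6, one_mul, hq, Padic.norm_p]

lemma norm_unitLog_le (a : ℤ_[p]ˣ) :
    ‖padicLog p (((a : ℤ_[p]) : ℚ_[p]) ^ Nat.totient (q p)) / (Nat.totient (q p) * q p : ℚ_[p])‖
      ≤ 1 := by
  rw [norm_div]
  exact div_le_one_of_le₀ ((norm_padicLog_le _ (norm_sub_one_le a).2).trans (norm_sub_one_le a).1)
    (norm_nonneg _)

/-- Write `a = ω ⟨a⟩` with `ω ∈ Δ ⊆ ℤ_pˣ` a root of unity, `ω ^ φ(q) = 1`, and `⟨a⟩ ∈ 1 + q ℤ_p`.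
This is `log ⟨a⟩ / q ∈ ℤ_p`, computed as `log (a ^ φ(q)) / (φ(q) q)`. -/
def unitLog (a : ℤ_[p]ˣ) : ℤ_[p] :=
  ⟨padicLog p (((a : ℤ_[p]) : ℚ_[p]) ^ Nat.totient (q p)) / (Nat.totient (q p) * q p : ℚ_[p]),
    norm_unitLog_le a⟩

/-- The class of `a` in `Δ = (ℤ/qℤ)ˣ`. -/
def unitClass (a : ℤ_[p]ˣ) : (ZMod (q p))ˣ :=
  Units.map (PadicInt.toZModPow (p := p) (qExp p)).toMonoidHom a

end Padic

/-! ### The Iwasawa algebra -/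

section Iwasawa

variable (p : ℕ) [Fact p.Prime]

/-- The Iwasawa algebra `Λ = ℤ_p⟦ℤ_pˣ⟧ = ℤ_p[Δ] ⊗ ℤ_p⟦T⟧ = ℤ_p[Δ]⟦T⟧`, where `Δ = (ℤ/qℤ)ˣ` and
`T` corresponds to `[exp q] - 1`. -/
def Iwasawa : Type := PowerSeries (MonoidAlgebra ℤ_[p] (ZMod (q p))ˣ)

instance : CommRing (Iwasawa p) :=
  inferInstanceAs (CommRing (PowerSeries (MonoidAlgebra ℤ_[p] (ZMod (q p))ˣ)))

instance : Algebra ℤ_[p] (Iwasawa p) :=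
  inferInstanceAs (Algebra ℤ_[p] (PowerSeries (MonoidAlgebra ℤ_[p] (ZMod (q p))ˣ)))

/-- The variable `T` of `Λ`. -/
def T : Iwasawa p := (PowerSeries.X : PowerSeries (MonoidAlgebra ℤ_[p] (ZMod (q p))ˣ))

/-- The ideal `𝔪_Λ = (p, T)` of `Λ`. -/
def mLambda : Ideal (Iwasawa p) := Ideal.span {(p : Iwasawa p), T p}

/-- `Λ` carries the `𝔪_Λ`-adic topology. -/
instance : TopologicalSpace (Iwasawa p) := (mLambda p).adicTopology

instance : IsTopologicalRing (Iwasawa p) :=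
  (mLambda p).adic_basis.toRing_subgroups_basis.toRingFilterBasis.isTopologicalRing

variable {p}

/-- The universal character `[-] : ℤ_pˣ → Λˣ`,
`[a] = [a mod q] · (1 + T) ^ (log ⟨a⟩ / q)`, where `(1 + T) ^ s = ∑ r, (s choose r) T ^ r`. -/
def univChar (a : ℤ_[p]ˣ) : Iwasawa p :=
  (PowerSeries.mk fun r => MonoidAlgebra.single (unitClass a) (Ring.choose (unitLog a) r) :
    PowerSeries (MonoidAlgebra ℤ_[p] (ZMod (q p))ˣ))

variable (p)

/-- The ring `Λ^{>1/p} = Λ⟦p T⁻¹⟧ = ℤ_p⟦T, p T⁻¹⟧ ⊗ ℤ_p[Δ]`, that is, `Λ⟦Y⟧ / (T Y - p)`. -/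
abbrev LambdaGt : Type :=
  PowerSeries (Iwasawa p) ⧸
    Ideal.span {PowerSeries.C (T p) * PowerSeries.X - (p : PowerSeries (Iwasawa p))}

/-- The canonical map `Λ → Λ^{>1/p}`. -/
def toLambdaGt : Iwasawa p →+* LambdaGt p :=
  (Ideal.Quotient.mk _).comp PowerSeries.C

end Iwasawa

/-! ### The action of the monoid `M₁` on functions on `ℤ_p` -/

section Action

variable {p : ℕ} [Fact p.Prime]

open Classical in
/-- The right action of `δ = (a b; c d)` (with `q ∣ c`, `p ∤ d`, `det δ ≠ 0`) on functions
`h : ℤ_p → Λ`, namely `(h ‖ δ)(z) = [c z + d] h((a z + b) / (c z + d))`. On such matrices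
`c z + d` is always a unit. On `Iw_q` this is the representation induced from the character `[-]`
of the lower right entry of the upper triangular Borel subgroup, written in the coordinate `z` of
the lower triangular unipotent matrix `(1 0; q z 1)`. -/
def slash (δ : Matrix (Fin 2) (Fin 2) ℤ_[p]) : (ℤ_[p] → Iwasawa p) →ₗ[Iwasawa p]
    (ℤ_[p] → Iwasawa p) where
  toFun h z :=
    if hu : IsUnit (δ 1 0 * z + δ 1 1) then
      univChar hu.unit * h ((δ 0 0 * z + δ 0 1) * ((hu.unit⁻¹ : ℤ_[p]ˣ) : ℤ_[p]))
    else 0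
  map_add' f g := by
    funext z
    by_cases hu : IsUnit (δ 1 0 * z + δ 1 1) <;> simp [hu, mul_add]
  map_smul' c f := by
    funext z
    by_cases hu : IsUnit (δ 1 0 * z + δ 1 1) <;> simp [hu, mul_left_comm]

variable (p)

/-- The subgroup `Iw_q` of `GL₂(ℤ_p)` of matrices whose lower left entry is divisible by `q`. -/
def iwahori : Subgroup (GL (Fin 2) ℤ_[p]) where
  carrier := {g | (q p : ℤ_[p]) ∣ (g : Matrix (Fin 2) (Fin 2) ℤ_[p]) 1 0}
  one_mem' := by simp
  mul_mem' {g h} hg hh := by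
    simp only [Set.mem_ofPred_eq, Units.val_mul, Matrix.mul_apply, Fin.sum_univ_two] at *
    exact dvd_add (hg.mul_right _) (hh.mul_left _)
  inv_mem' {g} hg := by
    simp only [Set.mem_ofPred_eq, Matrix.coe_units_inv, Matrix.inv_def, Matrix.adjugate_fin_two,
      Matrix.smul_apply] at *
    exact (dvd_neg.2 hg).mul_left _

/-- `GL₂(ℤ_p) → GL₂(ℚ_p)`. -/
def toGLQ : GL (Fin 2) ℤ_[p] →* GL (Fin 2) ℚ_[p] :=
  Matrix.GeneralLinearGroup.map (algebraMap ℤ_[p] ℚ_[p])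

/-- The integral matrix `v_j = (p 0; j q 1)`. The double coset `Iw_q (p 0; 0 1) Iw_q` is the
disjoint union of the `Iw_q v_j`, `0 ≤ j < p`. -/
def vMat (j : ℕ) : Matrix (Fin 2) (Fin 2) ℤ_[p] := !![(p : ℤ_[p]), 0; (j * q p : ℤ_[p]), 1]

/-- `v_j` as an element of `GL₂(ℚ_p)`. -/
def vGL (j : ℕ) : GL (Fin 2) ℚ_[p] :=
  Matrix.GeneralLinearGroup.mkOfDetNeZero ((vMat p j).map (algebraMap ℤ_[p] ℚ_[p])) (by
    have hp : (p : ℚ_[p]) ≠ 0 := by exact_mod_cast (Fact.out : p.Prime).ne_zero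
    simpa [vMat, Matrix.det_fin_two] using hp)

end Action

/-! ### Adeles and the definite quaternion algebra -/

section Adeles

instance factPrime (l : Nat.Primes) : Fact (l : ℕ).Prime := ⟨l.2⟩

/-- The ring `𝔸_f^{(p)}` of finite prime-to-`p` adeles: the restricted product of the `ℚ_l` with
respect to the `ℤ_l`, over all primes `l ≠ p`, with the restricted product topology. -/
abbrev AdelesAway (p : ℕ) : Type :=
  Πʳ l : {l : Nat.Primes // (l : ℕ) ≠ p}, [ℚ_[(l.1 : ℕ)], PadicInt.subring (l.1 : ℕ)]

/-- The diagonal embedding `ℚ → 𝔸_f^{(p)}`. -/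
def ratDiag (p : ℕ) : ℚ →+* AdelesAway p where
  toFun x := ⟨fun l => ((x : ℚ) : ℚ_[(l.1 : ℕ)]), by
    have hfin : Set.Finite {l : {l : Nat.Primes // (l : ℕ) ≠ p} | ((l.1 : ℕ)) ∣ x.den} := by
      refine Set.Finite.of_finite_image (f := fun l => ((l.1 : ℕ))) ?_ ?_
      · refine (Nat.divisors x.den).finite_toSet.subset ?_
        rintro _ ⟨l, hl, rfl⟩
        simpa [Nat.mem_divisors] using hl
      · intro a _ b _ h
        exact Subtype.ext (Subtype.ext h)
    refine Filter.mem_of_superset hfin.compl_mem_cofinite ?_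
    intro l hl
    exact Padic.norm_rat_le_one hl⟩
  map_one' := by ext l; simp
  map_mul' x y := by ext l; exact Rat.cast_mul x y
  map_zero' := by ext l; simp
  map_add' x y := by ext l; exact Rat.cast_add x y

instance (p : ℕ) : Algebra ℚ (AdelesAway p) := (ratDiag p).toAlgebra

/-- `D` is a definite quaternion algebra over `ℚ`: a central simple algebra of dimension `4` with
`D ⊗ ℝ` isomorphic to Hamilton's quaternions. -/
def IsDefiniteQuaternion (D : Type*) [Ring D] [Algebra ℚ D] : Prop :=
  Algebra.IsCentral ℚ D ∧ IsSimpleRing D ∧ Module.finrank ℚ D = 4 ∧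
    Nonempty (ℝ ⊗[ℚ] D ≃ₐ[ℝ] Quaternion ℝ)

variable (p : ℕ) [Fact p.Prime] (D : Type*) [Ring D] [Algebra ℚ D]

/-- The group `(D ⊗ 𝔸_f^{(p)})ˣ`. -/
abbrev TameGroup : Type _ := (AdelesAway p ⊗[ℚ] D)ˣ

/-- `D ⊗ 𝔸_f^{(p)}`, a finite free module over `𝔸_f^{(p)}`, carries the module topology. -/
instance : TopologicalSpace (AdelesAway p ⊗[ℚ] D) :=
  moduleTopology (AdelesAway p) (AdelesAway p ⊗[ℚ] D)

/-- The group `(D ⊗ 𝔸_f)ˣ = (D ⊗ 𝔸_f^{(p)})ˣ × GL₂(ℚ_p)`; the second factor is `(D ⊗ ℚ_p)ˣ`,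
identified with `GL₂(ℚ_p)` by a fixed isomorphism. -/
abbrev FinGroup : Type _ := TameGroup p D × GL (Fin 2) ℚ_[p]

variable {p D}

/-- The diagonal embedding `Dˣ → (D ⊗ 𝔸_f)ˣ`. -/
def diag (ι : ℚ_[p] ⊗[ℚ] D ≃ₐ[ℚ_[p]] Matrix (Fin 2) (Fin 2) ℚ_[p]) : Dˣ →* FinGroup p D :=
  (Units.map ((Algebra.TensorProduct.includeRight : D →ₐ[ℚ] AdelesAway p ⊗[ℚ] D) :
      D →* AdelesAway p ⊗[ℚ] D)).prod
    ((Units.map (ι : ℚ_[p] ⊗[ℚ] D →* Matrix (Fin 2) (Fin 2) ℚ_[p])).comp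
      (Units.map ((Algebra.TensorProduct.includeRight : D →ₐ[ℚ] ℚ_[p] ⊗[ℚ] D) :
        D →* ℚ_[p] ⊗[ℚ] D)))

/-- The level `K^p Iw_q ⊆ (D ⊗ 𝔸_f)ˣ`. -/
def level (Kp : Subgroup (TameGroup p D)) : Subgroup (FinGroup p D) :=
  Kp.prod ((iwahori p).map (toGLQ p))

/-- The tame level `K^p` is neat: `x⁻¹ Dˣ x ∩ K^p Iw_q = {1}` for all `x ∈ (D ⊗ 𝔸_f)ˣ`. -/
def IsNeat (ι : ℚ_[p] ⊗[ℚ] D ≃ₐ[ℚ_[p]] Matrix (Fin 2) (Fin 2) ℚ_[p])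
    (Kp : Subgroup (TameGroup p D)) : Prop :=
  ∀ (x : FinGroup p D) (δ : Dˣ), x⁻¹ * diag ι δ * x ∈ level Kp → x⁻¹ * diag ι δ * x = 1

/-- The elements `γ_0, …, γ_{t-1}` represent the double cosets
`Dˣ \ (D ⊗ 𝔸_f)ˣ / K^p Iw_q`, each exactly once, and have trivial `p`-component.
In particular `t` is the number of double cosets. -/
def IsRepresentatives (ι : ℚ_[p] ⊗[ℚ] D ≃ₐ[ℚ_[p]] Matrix (Fin 2) (Fin 2) ℚ_[p])
    (Kp : Subgroup (TameGroup p D)) {t : ℕ} (γ : Fin t → FinGroup p D) : Prop :=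
  Function.Bijective (fun i => DoubleCoset.mk (diag ι).range (level Kp) (γ i)) ∧
    ∀ i, (γ i).2 = 1

end Adeles

/-! ### Integral `p`-adic automorphic forms, the operator `U_p` and its matrix -/

section Forms

variable {p : ℕ} [Fact p.Prime] {D : Type*} [Ring D] [Algebra ℚ D]

/-- The space `S^D_int` of integral `p`-adic automorphic forms: functions
`φ : Dˣ \ (D ⊗ 𝔸_f)ˣ / K^p → 𝒞(ℤ_p; Λ)` with `φ(x u) = φ(x) ‖ u` for `u ∈ Iw_q`. -/
def SInt (ι : ℚ_[p] ⊗[ℚ] D ≃ₐ[ℚ_[p]] Matrix (Fin 2) (Fin 2) ℚ_[p])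
    (Kp : Subgroup (TameGroup p D)) :
    Submodule (Iwasawa p) (FinGroup p D → ℤ_[p] → Iwasawa p) where
  carrier := {φ | (∀ x, Continuous (φ x)) ∧
    (∀ (δ : Dˣ) (x : FinGroup p D), φ (diag ι δ * x) = φ x) ∧
    (∀ k ∈ Kp, ∀ x : FinGroup p D, φ (x * (k, 1)) = φ x) ∧
    (∀ u ∈ iwahori p, ∀ x : FinGroup p D,
      φ (x * (1, toGLQ p u)) = slash (u : Matrix (Fin 2) (Fin 2) ℤ_[p]) (φ x))}
  zero_mem' := ⟨fun _ => continuous_const, fun _ _ => rfl, fun _ _ _ => rfl,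
    fun _ _ _ => (map_zero _).symm⟩
  add_mem' := by
    rintro f g ⟨h1, h2, h3, h4⟩ ⟨k1, k2, k3, k4⟩
    refine ⟨fun x => (h1 x).add (k1 x), fun δ x => ?_, fun k hk x => ?_, fun u hu x => ?_⟩
    · simp only [Pi.add_apply, h2, k2]
    · simp only [Pi.add_apply, h3 k hk, k3 k hk]
    · simp only [Pi.add_apply, h4 u hu, k4 u hu, map_add]
  smul_mem' := by
    rintro c f ⟨h1, h2, h3, h4⟩
    refine ⟨fun x => continuous_const.mul (h1 x), fun δ x => ?_, fun k hk x => ?_, fun u hu x => ?_⟩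
    · simp only [Pi.smul_apply, h2]
    · simp only [Pi.smul_apply, h3 k hk]
    · simp only [Pi.smul_apply, h4 u hu, map_smul]

/-- The operator `U_p`: `(U_p φ)(x) = ∑_{j=0}^{p-1} φ(x v_j⁻¹) ‖ v_j`. -/
def Up (φ : FinGroup p D → ℤ_[p] → Iwasawa p) : FinGroup p D → ℤ_[p] → Iwasawa p :=
  fun x => ∑ j ∈ Finset.range p, slash (vMat p j) (φ (x * (1, (vGL p j)⁻¹)))

/-- `e` is the basis `1_0, …, 1_{t-1}, z_0, …, z_{t-1}, (z_0 choose 2), …` of `S^D_int`: the form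
`e (k t + i)` takes the value `(z choose k)` at `γ_i` and the value `0` at the other `γ`'s. -/
def IsMahlerBasis (ι : ℚ_[p] ⊗[ℚ] D ≃ₐ[ℚ_[p]] Matrix (Fin 2) (Fin 2) ℚ_[p])
    (Kp : Subgroup (TameGroup p D)) {t : ℕ} (γ : Fin t → FinGroup p D)
    (e : ℕ → FinGroup p D → ℤ_[p] → Iwasawa p) : Prop :=
  ∀ n, e n ∈ SInt ι Kp ∧ ∀ (i : Fin t) (z : ℤ_[p]),
    e n (γ i) z =
      if (i : ℕ) = n % t then algebraMap ℤ_[p] (Iwasawa p) (Ring.choose z (n / t)) else 0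

/-- `P = (P_{m,n})` is the matrix of `U_p` in the basis `e`: for each `n`, the coefficients
`P_{m,n}` tend to `0` as `m → ∞`, and `U_p (e n) = ∑ m, P_{m,n} e m`. -/
def IsMatrixOfUp (e : ℕ → FinGroup p D → ℤ_[p] → Iwasawa p) (P : ℕ → ℕ → Iwasawa p) : Prop :=
  ∀ n, Filter.Tendsto (fun m => P m n) Filter.atTop (nhds 0) ∧
    ∀ (x : FinGroup p D) (z : ℤ_[p]), HasSum (fun m => P m n * e m x z) (Up (e n) x z)

end Forms

/-! ### The characteristic power series -/

section Char

variable {p : ℕ} [Fact p.Prime]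

/-- `det (I_n - X (P_{i,j})_{0 ≤ i, j < n})`, a polynomial viewed in `Λ⟦X⟧`. -/
def minorChar (P : ℕ → ℕ → Iwasawa p) (n : ℕ) : PowerSeries (Iwasawa p) :=
  (1 - (PowerSeries.X : PowerSeries (Iwasawa p)) •
    Matrix.of fun i j : Fin n => (PowerSeries.C (P i j) : PowerSeries (Iwasawa p))).det

/-- `F = Char(P)`: in the `𝔪_Λ`-adic topology of `Λ⟦X⟧`, the series `F` is the limit of
`det (I_n - X (P_{i,j})_{0 ≤ i, j < n})` as `n → ∞`. -/
def IsCharSeries (P : ℕ → ℕ → Iwasawa p) (F : PowerSeries (Iwasawa p)) : Prop :=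
  Filter.Tendsto (minorChar P) Filter.atTop
    (@nhds _ ((mLambda p).map (PowerSeries.C : Iwasawa p →+* PowerSeries (Iwasawa p))).adicTopology F)

/-- The integers `λ(n)`, with `λ(0) = 0` and `λ(i+1) - λ(i) = ⌊i/t⌋ - ⌊i/(pt)⌋ ≥ 0`. -/
def lam (p t n : ℕ) : ℕ := ∑ i ∈ Finset.range n, (i / t - i / (p * t))

end Char

end IntegralForms

end

/-! Everything follows from one estimate on matrix entries, `IsMatrixOfUp.mem`: $P_{m,n}\in\mathfrak
m_\Lambda^{\lfloor m/t\rfloor-\lfloor n/(pt)\rfloor}$ (all differences of exponents truncated at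
$0$). By neatness a point $x$ determines its representative $\gamma_i$ and its
$\mathrm{Iw}_q$-component, so a form is an arbitrary $t$-tuple of continuous functions. The entries
of $P$ are then Mahler coefficients of $U_pe_n$ at the $\gamma_i$, that is, iterated forward
differences at $0$. Each summand of $U_pe_n$ at a point is either $0$ or $\binom zn\|_\delta$, with
$n$ replaced by $\lfloor n/t\rfloor$, where $\delta=uv_j$ has upper left entry divisible by $p$.

So it remains to bound the $m$-th difference of $[cz+d]\binom{h(z)}n$, where $h(z)=(az+b)/(cz+d)$
and $p\mid a$. The Leibniz rule separates the factors. For each, multiplicative differences are easy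
and `diffFiltered_of_mulDiff` turns them into additive ones. The $(k+1)$-st multiplicative
difference of $cz+d$ is $1$ modulo $p^kq$, and $[-]$ maps $1+p^kq\mathbb Z_p$ into $1+\mathfrak
m_\Lambda^{k+1}$. The binomials $\binom{h(z)}n$ are the coefficients of $(1+X)^{h(z)}$, whose $k$-th
multiplicative difference is $(1+X)^{\Delta^kh(z)}$ with $p^k\mid\Delta^kh(z)$. Reading off the
coefficient of $X^n$ loses at most $\lfloor n/p\rfloor$ powers of $p$.

In the Leibniz expansion of the determinant, the coefficient of $X^j$ involves permutations of
$j$-element index sets $S$. Permuting rows does not change the sum of the $\lfloor m/t\rfloor$ over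
$S$, so a product lies in $\mathfrak m_\Lambda$ to the power $\sum_{i\in S}(\lfloor
i/t\rfloor-\lfloor i/(pt)\rfloor)$. These weights are nondecreasing, so the minimum is $\lambda(j)$,
attained by the first $j$ indices. They also tend to infinity, which gives convergence. Finally
$p=TY$ in $\Lambda^{>1/p}$, so there $\mathfrak m_\Lambda$ generates $(T)$. -/

noncomputable section

namespace IntegralForms

/-! ### Forward differences and filtrations -/

section Differences

variable {M R : Type*} [AddCommMonoid M] [CommRing R]

/-- A decreasing multiplicative filtration of a ring by ideals. -/
structure IsFiltration (J : ℕ → Ideal R) : Prop where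
  zero : J 0 = ⊤
  anti : Antitone J
  mul : ∀ i j, J i * J j ≤ J (i + j)

lemma isFiltration_pow (I : Ideal R) : IsFiltration (fun i => I ^ i) where
  zero := by simp
  anti := fun _ _ h => Ideal.pow_le_pow_right h
  mul := fun i j => (pow_add I i j).ge

/-- The function `f` has `m`-th differences in `J m`. -/
def DiffFiltered (h : M) (J : ℕ → Ideal R) (f : M → R) : Prop :=
  ∀ m z, (fwdDiff h)^[m] f z ∈ J m

lemma fwdDiff_iter_shift (h : M) (f : M → R) (m : ℕ) (z : M) :
    (fwdDiff h)^[m] (fun x => f (x + h)) z = (fwdDiff h)^[m] f (z + h) :=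
  fwdDiff_iter_comp_add h f h m z

/-- Discrete Leibniz rule $\Delta(fg)=f(\cdot+h)\,\Delta g+\Delta f\cdot g$, iterated. The bounds
`A` and `B` are arbitrary sequences of ideals so that the induction may shift them, and only orders
up to `m` are assumed so that the lemma can serve inside strong inductions. -/
lemma fwdDiff_iter_mul_mem (h : M) (C : Ideal R) (m : ℕ) (A B : ℕ → Ideal R) (f g : M → R)
    (hf : ∀ i ≤ m, ∀ z, (fwdDiff h)^[i] f z ∈ A i) (hg : ∀ i ≤ m, ∀ z, (fwdDiff h)^[i] g z ∈ B i)
    (hC : ∀ i j, i + j = m → A i * B j ≤ C) (z : M) :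
    (fwdDiff h)^[m] (f * g) z ∈ C := by
  induction m generalizing A B f g z with
  | zero =>
    exact hC 0 0 rfl (Ideal.mul_mem_mul (hf 0 le_rfl z) (hg 0 le_rfl z))
  | succ m ih =>
    have key : fwdDiff h (f * g) = (fun x => f (x + h)) * fwdDiff h g + fwdDiff h f * g := by
      funext x
      simp only [fwdDiff, Pi.mul_apply, Pi.add_apply]
      ring
    rw [Function.iterate_succ_apply, key, fwdDiff_iter_add]
    refine C.add_mem ?_ ?_
    · refine ih A (fun i => B (i + 1)) _ _ (fun i hi x => ?_) (fun i hi x => ?_)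
        (fun i j hij => hC i (j + 1) (by omega)) z
      · rw [fwdDiff_iter_shift]
        exact hf i (by omega) _
      · rw [← Function.iterate_succ_apply]
        exact hg (i + 1) (by omega) x
    · refine ih (fun i => A (i + 1)) B _ _ (fun i hi x => ?_) (fun i hi x => hg i (by omega) x)
        (fun i j hij => hC (i + 1) j (by omega)) z
      rw [← Function.iterate_succ_apply]
      exact hf (i + 1) (by omega) x

lemma fwdDiff_iter_const (h : M) (c : R) (m : ℕ) (hm : m ≠ 0) (z : M) :
    (fwdDiff h)^[m] (fun _ => c) z = 0 := by
  obtain ⟨k, rfl⟩ := Nat.exists_eq_succ_of_ne_zero hm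
  rw [Function.iterate_succ_apply, fwdDiff_const, fwdDiff_iter_eq_sum_shift]
  simp

lemma diffFiltered_const (h : M) {J : ℕ → Ideal R} (hJ : IsFiltration J) (c : R) :
    DiffFiltered h J (fun _ => c) := by
  intro m z
  rcases eq_or_ne m 0 with rfl | hm
  · simp [hJ.zero]
  · rw [fwdDiff_iter_const h c m hm]
    exact zero_mem _

lemma DiffFiltered.add {h : M} {J : ℕ → Ideal R} {f g : M → R}
    (hf : DiffFiltered h J f) (hg : DiffFiltered h J g) : DiffFiltered h J (f + g) := by
  intro m z
  rw [fwdDiff_iter_add]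
  exact (J m).add_mem (hf m z) (hg m z)

lemma DiffFiltered.mul {h : M} {J : ℕ → Ideal R} (hJ : IsFiltration J) {f g : M → R}
    (hf : DiffFiltered h J f) (hg : DiffFiltered h J g) : DiffFiltered h J (f * g) := fun m =>
  fwdDiff_iter_mul_mem h _ m J J f g (fun i _ => hf i) (fun i _ => hg i)
    (fun i j hij => hij ▸ hJ.mul i j)

/-- For $g=1/f$ one has $\Delta g=-\Delta f\cdot g\cdot g(\cdot+h)$, so the differences of $g$ of
order $m+1$ are controlled by those of order at most $m$, with one step of the filtration supplied
by $\Delta f$. -/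
lemma DiffFiltered.inv {h : M} {J : ℕ → Ideal R} (hJ : IsFiltration J) {f g : M → R}
    (hf : DiffFiltered h J f) (hfg : ∀ z, f z * g z = 1) : DiffFiltered h J g := by
  intro m
  induction m using Nat.strong_induction_on with
  | _ m ih =>
    rcases m with _ | m
    · intro z
      simp [hJ.zero]
    · intro z
      have key : fwdDiff h g = (fun _ => (-1 : R)) * (fwdDiff h f * (g * fun x => g (x + h))) := by
        funext x
        simp only [fwdDiff, Pi.mul_apply]
        linear_combination g x * hfg (x + h) - g (x + h) * hfg x
      rw [Function.iterate_succ_apply, key]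
      refine fwdDiff_iter_mul_mem h _ m J (fun i => J (i + 1)) _ _
        (fun i _ => diffFiltered_const h hJ _ i) (fun k hk => ?_) (fun i j hij => ?_) z
      · refine fwdDiff_iter_mul_mem h _ k (fun i => J (i + 1)) J _ _
          (fun i _ x => ?_) (fun l hl => ?_) (fun i j hij => ?_)
        · rw [← Function.iterate_succ_apply]
          exact hf (i + 1) x
        · refine fwdDiff_iter_mul_mem h _ l J J _ _ (fun i hi => ih i (by omega))
            (fun i hi x => ?_) (fun i j hij => hij ▸ hJ.mul i j)
          rw [fwdDiff_iter_shift]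
          exact ih i (by omega) _
        · have := hJ.mul (i + 1) j
          rwa [show i + 1 + j = k + 1 by omega] at this
      · have := hJ.mul i (j + 1)
        rwa [show i + (j + 1) = m + 1 by omega] at this

/-- If the `k`-th multiplicative differences of `G 0` are congruent to `1` modulo `J k`, then its
additive `m`-th differences lie in `J m`. -/
lemma diffFiltered_of_mulDiff {h : M} {J : ℕ → Ideal R} (hJ : IsFiltration J) (G : ℕ → M → R)
    (hG : ∀ k z, G k (z + h) = G k z * G (k + 1) z) (h1 : ∀ k z, G k z - 1 ∈ J k) :
    DiffFiltered h J (G 0) := by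
  -- All levels `k` are treated together: $\Delta(G_k-1)=G_k\,(G_{k+1}-1)$ exchanges one difference
  -- for one more level.
  have key : ∀ m k z, (fwdDiff h)^[m] (fun x => G k x - 1) z ∈ J (m + k) := by
    intro m
    induction m using Nat.strong_induction_on with
    | _ m ih =>
      rcases m with _ | m
      · intro k z
        simpa using h1 k z
      · intro k z
        have e : fwdDiff h (fun x => G k x - 1) = G k * fun x => G (k + 1) x - 1 := by
          funext x
          simp only [fwdDiff, Pi.mul_apply, hG]
          ring
        have e2 : G k = (fun x => G k x - 1) + fun _ => (1 : R) := by
          funext x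
          simp
        rw [Function.iterate_succ_apply, e]
        refine fwdDiff_iter_mul_mem h _ m J (fun j => J (j + (k + 1))) _ _
          (fun i hi x => ?_) (fun i hi x => ih i (by omega) (k + 1) x) (fun i j hij => ?_) z
        · rw [e2, fwdDiff_iter_add]
          exact (J i).add_mem (hJ.anti (by omega) (ih i (by omega) k x))
            (diffFiltered_const h hJ _ i x)
        · have := hJ.mul i (j + (k + 1))
          rwa [show i + (j + (k + 1)) = m + 1 + k by omega] at this
  have e2 : G 0 = (fun x => G 0 x - 1) + fun _ => (1 : R) := by
    funext x
    simp
  rw [e2]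
  exact DiffFiltered.add (fun m z => key m 0 z) (diffFiltered_const h hJ 1)

end Differences

/-! ### Weighted filtrations of power series rings -/

section Weights

variable {A : Type*} [CommRing A]

/-- The ideal of power series whose `n`-th coefficient is divisible by `π ^ (i - w n)`. -/
def weightIdeal (π : A) (w : ℕ → ℕ) (hw : ∀ a b, w a + w b ≤ w (a + b)) (i : ℕ) :
    Ideal (PowerSeries A) where
  carrier := {f | ∀ n, π ^ (i - w n) ∣ PowerSeries.coeff n f}
  zero_mem' := fun n => by simp
  add_mem' := fun hf hg n => by
    rw [map_add]
    exact dvd_add (hf n) (hg n)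
  smul_mem' := fun c f hf n => by
    rw [smul_eq_mul, PowerSeries.coeff_mul]
    refine Finset.dvd_sum fun x hx => ?_
    have h1 := hw x.1 x.2
    rw [Finset.HasAntidiagonal.mem_antidiagonal.1 hx] at h1
    exact ((pow_dvd_pow π (by omega)).trans (hf x.2)).mul_left _

lemma isFiltration_weightIdeal (π : A) (w : ℕ → ℕ) (hw : ∀ a b, w a + w b ≤ w (a + b)) :
    IsFiltration (weightIdeal π w hw) where
  zero := by
    rw [Ideal.eq_top_iff_one]
    intro n
    simp
  anti := fun i j hij f hf n => (pow_dvd_pow π (by omega)).trans (hf n)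
  mul := fun i j => by
    rw [Ideal.mul_le]
    intro f hf g hg n
    rw [PowerSeries.coeff_mul]
    refine Finset.dvd_sum fun x hx => ?_
    have h1 := hw x.1 x.2
    rw [Finset.HasAntidiagonal.mem_antidiagonal.1 hx] at h1
    refine dvd_trans (pow_dvd_pow π ?_) (pow_add π _ _ ▸ mul_dvd_mul (hf x.1) (hg x.2))
    omega

/-- The powers of the ideal `(π, X)` of a power series ring. -/
lemma span_pair_X_pow (π : A) (i : ℕ) :
    (Ideal.span {PowerSeries.C π, PowerSeries.X} : Ideal (PowerSeries A)) ^ i =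
      weightIdeal π id (fun _ _ => le_rfl) i := by
  set I : Ideal (PowerSeries A) := Ideal.span {PowerSeries.C π, PowerSeries.X}
  have hC : PowerSeries.C π ∈ I := Ideal.subset_span (by simp)
  have hX : (PowerSeries.X : PowerSeries A) ∈ I := Ideal.subset_span (by simp)
  have hF := isFiltration_weightIdeal π id (fun _ _ => le_rfl)
  apply le_antisymm
  · induction i with
    | zero => simp [hF.zero]
    | succ i ih =>
      rw [pow_succ]
      refine (Ideal.mul_mono ih ?_).trans (hF.mul i 1)
      rw [Ideal.span_le]
      rintro _ (rfl | rfl) n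
      · rcases n with _ | n <;> simp [PowerSeries.coeff_C]
      · rcases n with _ | n <;> simp
  · intro f hf
    induction i generalizing f with
    | zero => simp
    | succ i ih =>
      -- The constant coefficient carries $\pi^{i+1}$; the rest is $X$ times a series satisfying the
      -- condition for $i$.
      obtain ⟨a, ha⟩ := hf 0
      have e : f = PowerSeries.C π ^ (i + 1) * PowerSeries.C a +
          PowerSeries.X * PowerSeries.mk fun n => PowerSeries.coeff (n + 1) f := by
        rw [← map_pow, ← map_mul]
        conv_lhs => rw [PowerSeries.eq_X_mul_shift_add_const f]
        rw [add_comm]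
        congr 2
        simpa using ha
      rw [e]
      refine Ideal.add_mem _ (Ideal.mul_mem_right _ _ (Ideal.pow_mem_pow hC _)) ?_
      rw [pow_succ']
      refine Ideal.mul_mem_mul hX (ih fun n => ?_)
      have := hf (n + 1)
      simpa using this

end Weights

/-! ### The logarithm and the universal character are homomorphisms -/

section Log

open Filter Topology

lemma qExp_pos {p : ℕ} : 0 < qExp p := by
  unfold qExp
  split_ifs <;> simp

variable {p : ℕ} [Fact p.Prime]

/-- $p^n-1\to-1$ in $\mathbb Z_p$, binomials are continuous, and $\binom{-1}m=(-1)^m$. These limits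
are the signs in the logarithm series. -/
lemma tendsto_choose_prime_pow_sub_one (m : ℕ) :
    Tendsto (fun n : ℕ => (((p ^ n - 1).choose m : ℕ) : ℚ_[p])) atTop (𝓝 ((-1) ^ m)) := by
  have hp : p.Prime := Fact.out
  have h1 : Tendsto (fun n : ℕ => ((p : ℤ_[p]) ^ n - 1)) atTop (𝓝 (-1)) := by
    have : Tendsto (fun n : ℕ => (p : ℤ_[p]) ^ n) atTop (𝓝 0) := by
      refine tendsto_pow_atTop_nhds_zero_of_norm_lt_one ?_
      rw [PadicInt.norm_p]
      exact inv_lt_one_of_one_lt₀ (by exact_mod_cast hp.one_lt)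
    simpa using this.sub_const 1
  have h2 := ((PadicInt.continuous_choose (p := p) m).tendsto (-1)).comp h1
  have h3 : Ring.choose (-1 : ℤ_[p]) m = (-1) ^ m := by
    rw [Ring.choose_neg, show (1 : ℤ_[p]) + m - 1 = (m : ℕ) by ring, Ring.choose_natCast,
      Nat.choose_self]
    simp [Units.smul_def, Int.negOnePow]
  rw [h3] at h2
  have h4 : Tendsto (fun n : ℕ => ((Ring.choose ((p : ℤ_[p]) ^ n - 1) m : ℤ_[p]) : ℚ_[p])) atTop
      (𝓝 (((-1) ^ m : ℤ_[p]) : ℚ_[p])) := (continuous_subtype_val.tendsto _).comp h2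
  rw [PadicInt.coe_pow, PadicInt.coe_neg, PadicInt.coe_one] at h4
  refine Tendsto.congr (fun n => ?_) h4
  have h5 : ((p : ℤ_[p]) ^ n - 1) = ((p ^ n - 1 : ℕ) : ℤ_[p]) := by
    rw [Nat.cast_sub (Nat.one_le_pow _ _ hp.pos)]
    push_cast
    ring
  rw [h5, Ring.choose_natCast, PadicInt.coe_natCast]

lemma norm_natCast_succ_ge (m : ℕ) : ((m + 1 : ℕ) : ℝ)⁻¹ ≤ ‖((m + 1 : ℕ) : ℚ_[p])‖ := by
  have hp : p.Prime := Fact.out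
  have hp0 : (0 : ℝ) < p := by exact_mod_cast hp.pos
  have hn : ((m + 1 : ℕ) : ℚ_[p]) ≠ 0 := by exact_mod_cast Nat.succ_ne_zero m
  rw [Padic.norm_eq_zpow_neg_valuation hn, Padic.valuation_natCast, zpow_neg, zpow_natCast]
  refine inv_anti₀ (by positivity) ?_
  exact_mod_cast Nat.le_of_dvd (Nat.succ_pos m) pow_padicValNat_dvd

/-- The logarithm as the derivative of `s ↦ x ^ s` at `s = 0`. -/
lemma tendsto_padicLog (x : ℚ_[p]) (hx : ‖x - 1‖ ≤ (p : ℝ)⁻¹) :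
    Tendsto (fun n : ℕ => (x ^ p ^ n - 1) / (p : ℚ_[p]) ^ n) atTop (𝓝 (padicLog p x)) := by
  have hp : p.Prime := Fact.out
  have hpQ : (p : ℚ_[p]) ≠ 0 := by exact_mod_cast hp.ne_zero
  set y := x - 1 with hy
  -- The binomial expansion of $((1+y)^{p^n}-1)/p^n$, using
  -- $\binom{p^n}{m+1}/p^n=\binom{p^n-1}m/(m+1)$. The bound $(m+1)p^{-(m+1)}$ then permits passing
  -- to the limit termwise.
  let F : ℕ → ℕ → ℚ_[p] := fun n m =>
    (((p ^ n - 1).choose m : ℕ) : ℚ_[p]) * y ^ (m + 1) / ((m + 1 : ℕ) : ℚ_[p])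
  have hF : ∀ n, (x ^ p ^ n - 1) / (p : ℚ_[p]) ^ n = ∑' m, F n m := by
    intro n
    have hN : 0 < p ^ n := pow_pos hp.pos n
    rw [tsum_eq_sum (s := Finset.range (p ^ n)) (by
      intro m hm
      have : p ^ n - 1 < m := by
        rw [Finset.mem_range] at hm
        omega
      simp [F, Nat.choose_eq_zero_of_lt this])]
    rw [div_eq_iff (pow_ne_zero _ hpQ), Finset.sum_mul]
    have hx' : x = y + 1 := by simp [hy]
    rw [hx', add_pow, Finset.sum_range_succ']
    simp only [one_pow, mul_one, pow_zero, Nat.choose_zero_right, Nat.cast_one, add_sub_cancel_right]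
    refine Finset.sum_congr rfl fun m _ => ?_
    have h1 := Nat.add_one_mul_choose_eq (p ^ n - 1) m
    rw [Nat.sub_add_cancel hN] at h1
    have h2 : ((p : ℚ_[p]) ^ n) * ((p ^ n - 1).choose m : ℕ) =
        ((p ^ n).choose (m + 1) : ℕ) * ((m + 1 : ℕ) : ℚ_[p]) := by exact_mod_cast h1
    have hm : ((m + 1 : ℕ) : ℚ_[p]) ≠ 0 := by exact_mod_cast Nat.succ_ne_zero m
    rw [div_mul_eq_mul_div, eq_div_iff hm]
    linear_combination (-y ^ (m + 1)) * h2
  simp only [hF]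
  rw [padicLog]
  have hr : ‖((p : ℝ)⁻¹)‖ < 1 := by
    rw [Real.norm_of_nonneg (by positivity)]
    exact inv_lt_one_of_one_lt₀ (by exact_mod_cast hp.one_lt)
  have hs : Summable fun m : ℕ => ((m : ℝ) ^ 1 * ((p : ℝ)⁻¹) ^ m) :=
    summable_pow_mul_geometric_of_norm_lt_one 1 hr
  refine tendsto_tsum_of_dominated_convergence ((summable_nat_add_iff 1).2 hs) (fun m => ?_)
    (Eventually.of_forall fun n m => ?_)
  · have := ((tendsto_choose_prime_pow_sub_one (p := p) m).mul_const (y ^ (m + 1))).div_const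
      ((m + 1 : ℕ) : ℚ_[p])
    exact this
  · rw [norm_div, norm_mul, norm_pow, pow_one]
    have h1 : ‖(((p ^ n - 1).choose m : ℕ) : ℚ_[p])‖ ≤ 1 := by
      simpa using Padic.norm_int_le_one (p := p) ((p ^ n - 1).choose m : ℕ)
    have h2 := norm_natCast_succ_ge (p := p) m
    have h3 : (0 : ℝ) < ((m + 1 : ℕ) : ℝ) := by positivity
    have h4 : 0 < ‖((m + 1 : ℕ) : ℚ_[p])‖ := lt_of_lt_of_le (by positivity) h2
    rw [div_eq_mul_inv, mul_comm]
    refine mul_le_mul ?_ ?_ (by positivity) (by positivity)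
    · rw [inv_le_comm₀ h4 h3]
      exact h2
    · exact (mul_le_of_le_one_left (by positivity) h1).trans
        (pow_le_pow_left₀ (norm_nonneg _) hx _)

/-- With $L_n(x)=(x^{p^n}-1)/p^n$ one has $L_n(xy)=L_n(x)\,(1+p^nL_n(y))+L_n(y)$, and the cross term
vanishes in the limit. -/
lemma padicLog_mul (x y : ℚ_[p]) (hx : ‖x - 1‖ ≤ (p : ℝ)⁻¹) (hy : ‖y - 1‖ ≤ (p : ℝ)⁻¹) :
    padicLog p (x * y) = padicLog p x + padicLog p y := by
  have hp : p.Prime := Fact.out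
  have hp1 : (p : ℝ)⁻¹ ≤ 1 := inv_le_one_of_one_le₀ (by exact_mod_cast hp.one_lt.le)
  have hpQ : (p : ℚ_[p]) ≠ 0 := by exact_mod_cast hp.ne_zero
  have hy1 : ‖y‖ ≤ 1 := by
    have : y = (y - 1) + 1 := by ring
    rw [this]
    exact (IsUltrametricDist.norm_add_le_max _ _).trans (max_le (hy.trans hp1) (by simp))
  have hxy : ‖x * y - 1‖ ≤ (p : ℝ)⁻¹ := by
    have : x * y - 1 = (x - 1) * y + (y - 1) := by ring
    rw [this]
    refine (IsUltrametricDist.norm_add_le_max _ _).trans (max_le ?_ hy)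
    rw [norm_mul]
    exact (mul_le_of_le_one_right (norm_nonneg _) hy1).trans hx
  have hpn : Tendsto (fun n : ℕ => (p : ℚ_[p]) ^ n) atTop (𝓝 0) := by
    refine tendsto_pow_atTop_nhds_zero_of_norm_lt_one ?_
    rw [Padic.norm_p]
    exact inv_lt_one_of_one_lt₀ (by exact_mod_cast hp.one_lt)
  have h1 := tendsto_padicLog x hx
  have h2 := tendsto_padicLog y hy
  have h3 := (h1.mul ((h2.mul hpn).add_const 1)).add h2
  refine tendsto_nhds_unique (tendsto_padicLog _ hxy) (Tendsto.congr (fun n => ?_) (by simpa using h3))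
  have := pow_ne_zero n hpQ
  field_simp
  ring

lemma padicLog_one : padicLog p 1 = 0 := by
  have h := padicLog_mul (p := p) 1 1 (by simp) (by simp)
  simpa using h

lemma padicLog_pow (x : ℚ_[p]) (hx : ‖x - 1‖ ≤ (p : ℝ)⁻¹) (n : ℕ) :
    padicLog p (x ^ n) = n * padicLog p x ∧ ‖x ^ n - 1‖ ≤ (p : ℝ)⁻¹ := by
  induction n with
  | zero => simp [padicLog_one]
  | succ n ih =>
    refine ⟨?_, ?_⟩
    · rw [pow_succ, padicLog_mul _ _ ih.2 hx, ih.1]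
      push_cast
      ring
    · have hp : p.Prime := Fact.out
      have hp1 : (p : ℝ)⁻¹ ≤ 1 := inv_le_one_of_one_le₀ (by exact_mod_cast hp.one_lt.le)
      have hy1 : ‖x‖ ≤ 1 := by
        have : x = (x - 1) + 1 := by ring
        rw [this]
        exact (IsUltrametricDist.norm_add_le_max _ _).trans (max_le (hx.trans hp1) (by simp))
      have : x ^ (n + 1) - 1 = (x ^ n - 1) * x + (x - 1) := by ring
      rw [this]
      refine (IsUltrametricDist.norm_add_le_max _ _).trans (max_le ?_ hx)
      rw [norm_mul]
      exact (mul_le_of_le_one_right (norm_nonneg _) hy1).trans ih.2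

lemma unitLog_mul (a b : ℤ_[p]ˣ) : unitLog (a * b) = unitLog a + unitLog b := by
  apply Subtype.ext
  rw [PadicInt.coe_add]
  simp only [unitLog]
  rw [Units.val_mul, PadicInt.coe_mul, mul_pow,
    padicLog_mul _ _ (norm_sub_one_le a).2 (norm_sub_one_le b).2, add_div]

lemma unitLog_one : unitLog (1 : ℤ_[p]ˣ) = 0 := by
  have h := unitLog_mul (1 : ℤ_[p]ˣ) 1
  simpa using h

/-- Since $a$ itself is close to $1$, $\log(a^{\varphi(q)})=\varphi(q)\log a$. The factor
$\varphi(q)$ cancels, and $|\log a|\le|a-1|$ concludes. -/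
lemma dvd_unitLog (a : ℤ_[p]ˣ) (k : ℕ) (ha : (p : ℤ_[p]) ^ k * (q p : ℕ) ∣ (a : ℤ_[p]) - 1) :
    (p : ℤ_[p]) ^ k ∣ unitLog a := by
  have hp : p.Prime := Fact.out
  have hq0 : (q p : ℚ_[p]) ≠ 0 := by
    exact_mod_cast (pow_pos hp.pos _).ne'
  have ht0 : (Nat.totient (q p) : ℚ_[p]) ≠ 0 := by
    exact_mod_cast (Nat.totient_pos.2 (pow_pos hp.pos _)).ne'
  have h1 : ‖((a : ℤ_[p]) : ℚ_[p]) - 1‖ ≤ ‖(p : ℚ_[p]) ^ k * (q p : ℕ)‖ := by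
    obtain ⟨c, hc⟩ := ha
    have : ((a : ℤ_[p]) : ℚ_[p]) - 1 = (p : ℚ_[p]) ^ k * (q p : ℕ) * c := by
      have := congrArg (fun x : ℤ_[p] => (x : ℚ_[p])) hc
      simpa using this
    rw [this, norm_mul]
    exact mul_le_of_le_one_right (norm_nonneg _) c.2
  have hp1 : (p : ℝ)⁻¹ ≤ 1 := inv_le_one_of_one_le₀ (by exact_mod_cast hp.one_lt.le)
  have h2 : ‖((a : ℤ_[p]) : ℚ_[p]) - 1‖ ≤ (p : ℝ)⁻¹ := by
    refine h1.trans ?_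
    have hq : (q p : ℚ_[p]) = (p : ℚ_[p]) ^ qExp p := by simp [q]
    rw [hq, ← pow_add, norm_pow, Padic.norm_p]
    exact pow_le_of_le_one (by positivity) hp1 (by have := qExp_pos (p := p); omega)
  rw [← PadicInt.norm_le_pow_iff_mem_span_pow _ k |>.trans Ideal.mem_span_singleton]
  have h3 : ‖unitLog a‖ ≤ ‖(p : ℚ_[p]) ^ k‖ := by
    rw [PadicInt.norm_def]
    simp only [unitLog]
    rw [(padicLog_pow _ h2 _).1, mul_div_mul_left _ _ ht0, norm_div,
      div_le_iff₀ (norm_pos_iff.2 hq0), ← norm_mul]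
    exact (norm_padicLog_le _ h2).trans h1
  simpa using h3

lemma unitClass_mul (a b : ℤ_[p]ˣ) : unitClass (a * b) = unitClass a * unitClass b := map_mul _ _ _

lemma unitClass_eq_one (a : ℤ_[p]ˣ) (ha : ((q p : ℕ) : ℤ_[p]) ∣ (a : ℤ_[p]) - 1) :
    unitClass a = 1 := by
  apply Units.ext
  have h : (a : ℤ_[p]) - 1 ∈ RingHom.ker (PadicInt.toZModPow (p := p) (qExp p)) := by
    rw [PadicInt.ker_toZModPow, Ideal.mem_span_singleton]
    simpa [q] using ha
  rw [RingHom.mem_ker, map_sub, map_one, sub_eq_zero] at h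
  exact h

/-- `[a]` is the class of `a` in `Δ` times the binomial series `(1 + T) ^ s`, `s = log ⟨a⟩ / q`. -/
lemma univChar_eq (a : ℤ_[p]ˣ) :
    univChar a = (PowerSeries.C (MonoidAlgebra.single (unitClass a) 1) *
      PowerSeries.binomialSeries (MonoidAlgebra ℤ_[p] (ZMod (q p))ˣ) (unitLog a) :
      PowerSeries (MonoidAlgebra ℤ_[p] (ZMod (q p))ˣ)) := by
  refine PowerSeries.ext (R := MonoidAlgebra ℤ_[p] (ZMod (q p))ˣ) fun r => ?_
  rw [univChar, PowerSeries.coeff_mk, PowerSeries.coeff_C_mul, PowerSeries.binomialSeries_coeff,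
    mul_smul_comm, mul_one, MonoidAlgebra.smul_single, smul_eq_mul, mul_one]

lemma univChar_mul (a b : ℤ_[p]ˣ) : univChar (a * b) = univChar a * univChar b := by
  have h : (PowerSeries.C (MonoidAlgebra.single (unitClass a * unitClass b) 1) *
      (PowerSeries.binomialSeries _ (unitLog a) * PowerSeries.binomialSeries _ (unitLog b)) :
      PowerSeries (MonoidAlgebra ℤ_[p] (ZMod (q p))ˣ)) =
      (PowerSeries.C (MonoidAlgebra.single (unitClass a) 1) *
        PowerSeries.binomialSeries _ (unitLog a)) *
      (PowerSeries.C (MonoidAlgebra.single (unitClass b) 1) *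
        PowerSeries.binomialSeries _ (unitLog b)) := by
    rw [mul_mul_mul_comm, ← map_mul, MonoidAlgebra.single_mul_single, mul_one]
  rw [univChar_eq, univChar_eq, univChar_eq, unitClass_mul, unitLog_mul,
    PowerSeries.binomialSeries_add]
  exact h

lemma univChar_one : univChar (1 : ℤ_[p]ˣ) = 1 := by
  rw [univChar_eq, unitLog_one, PowerSeries.binomialSeries_zero, unitClass_eq_one 1 (by simp)]
  rw [← MonoidAlgebra.one_def, map_one, mul_one]
  rfl

/-- From $r\binom sr=s\binom{s-1}{r-1}$: only the $p$-part of $r$ is lost. -/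
lemma prime_pow_dvd_choose (s : ℤ_[p]) (j r : ℕ) (hs : (p : ℤ_[p]) ^ j ∣ s) (hr : r ≠ 0) :
    (p : ℤ_[p]) ^ (j - padicValNat p r) ∣ Ring.choose s r := by
  have hp : p.Prime := Fact.out
  have h1 := Ring.choose_smul_choose s (n := r) (k := 1) (by omega)
  rw [Nat.choose_one_right, Ring.choose_one_right, nsmul_eq_mul] at h1
  have h2 : (p : ℤ_[p]) ^ j ∣ (r : ℤ_[p]) * Ring.choose s r := h1 ▸ hs.mul_right _
  rcases Nat.le_total j (padicValNat p r) with h | h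
  · simp [Nat.sub_eq_zero_of_le h]
  obtain ⟨u, hu⟩ : p ^ padicValNat p r ∣ r := pow_padicValNat_dvd
  have hu1 : ¬ p ∣ u := by
    rintro ⟨v, rfl⟩
    refine pow_succ_padicValNat_not_dvd (p := p) hr ⟨v, ?_⟩
    conv_lhs => rw [hu]
    ring
  have hu2 : IsUnit (u : ℤ_[p]) := by
    rw [PadicInt.isUnit_iff]
    simpa using (Padic.norm_natCast_eq_one_iff (p := p)).2 ((hp.coprime_iff_not_dvd).2 hu1)
  have h3 : (p : ℤ_[p]) ^ padicValNat p r * (p : ℤ_[p]) ^ (j - padicValNat p r) ∣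
      (p : ℤ_[p]) ^ padicValNat p r * (u * Ring.choose s r) := by
    rw [← pow_add, Nat.add_sub_cancel' h, ← mul_assoc]
    have : (r : ℤ_[p]) = (p : ℤ_[p]) ^ padicValNat p r * u := by exact_mod_cast congrArg (Nat.cast : ℕ → ℤ_[p]) hu
    rwa [this] at h2
  have hp0 : (p : ℤ_[p]) ≠ 0 := by exact_mod_cast hp.ne_zero
  exact (hu2.dvd_mul_left).1 ((mul_dvd_mul_iff_left (pow_ne_zero _ hp0)).1 h3)

/-- The coordinates of an element of `Λ = ℤ_p[Δ]⟦T⟧`. -/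
def coord : Iwasawa p →+ (ℕ → (ZMod (q p))ˣ → ℤ_[p]) where
  toFun x n g := (PowerSeries.coeff n (x : PowerSeries (MonoidAlgebra ℤ_[p] (ZMod (q p))ˣ))).coeff g
  map_zero' := by
    funext n g
    exact congrArg (fun a : MonoidAlgebra ℤ_[p] (ZMod (q p))ˣ => a.coeff g) (map_zero (PowerSeries.coeff n))
  map_add' x y := by
    funext n g
    exact congrArg (fun a : MonoidAlgebra ℤ_[p] (ZMod (q p))ˣ => a.coeff g)
      (map_add (PowerSeries.coeff n) _ _)

end Log

/-! ### The topology of the Iwasawa algebra -/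

section IwasawaTopology

open Filter Topology

variable {p : ℕ} [Fact p.Prime]

/-- A power series with coefficients in `ℤ_p[Δ]` as an element of `Λ`. -/
def ofSeries (f : PowerSeries (MonoidAlgebra ℤ_[p] (ZMod (q p))ˣ)) : Iwasawa p := f

lemma coord_mk (a : ℕ → MonoidAlgebra ℤ_[p] (ZMod (q p))ˣ) (n : ℕ) (g : (ZMod (q p))ˣ) :
    coord (ofSeries (PowerSeries.mk a)) n g = (a n).coeff g :=
  congrArg (fun b : MonoidAlgebra ℤ_[p] (ZMod (q p))ˣ => b.coeff g) (PowerSeries.coeff_mk n a)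

lemma natCast_pow_dvd_iff (a : MonoidAlgebra ℤ_[p] (ZMod (q p))ˣ) (k : ℕ) :
    (p : MonoidAlgebra ℤ_[p] (ZMod (q p))ˣ) ^ k ∣ a ↔ ∀ g, (p : ℤ_[p]) ^ k ∣ a.coeff g := by
  have hsm : ∀ b : MonoidAlgebra ℤ_[p] (ZMod (q p))ˣ,
      (p : MonoidAlgebra ℤ_[p] (ZMod (q p))ˣ) ^ k * b = (p : ℤ_[p]) ^ k • b := fun b => by
    rw [Algebra.smul_def, map_pow, map_natCast]
  constructor
  · rintro ⟨b, rfl⟩ g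
    rw [hsm, MonoidAlgebra.coeff_smul]
    exact ⟨_, rfl⟩
  · intro h
    choose b hb using h
    refine ⟨MonoidAlgebra.ofCoeff (Finsupp.equivFunOnFinite.symm b), ?_⟩
    rw [hsm]
    apply MonoidAlgebra.coeff_injective
    ext g
    rw [MonoidAlgebra.coeff_smul, hb g]
    rfl

/-- Reduces membership in $(p,T)^i$ to divisibilities in $\mathbb Z_p$: in degree $n$, $T^n$ already
supplies $n$ of the $i$ factors. -/
lemma mem_mLambda_pow {x : Iwasawa p} {i : ℕ} :
    x ∈ mLambda p ^ i ↔ ∀ n g, (p : ℤ_[p]) ^ (i - n) ∣ coord x n g := by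
  have h1 : mLambda p = (Ideal.span {PowerSeries.C (p : MonoidAlgebra ℤ_[p] (ZMod (q p))ˣ),
      PowerSeries.X} : Ideal (PowerSeries (MonoidAlgebra ℤ_[p] (ZMod (q p))ˣ))) := by
    rw [map_natCast]
    rfl
  rw [h1]
  refine (SetLike.ext_iff.1 (span_pair_X_pow (p : MonoidAlgebra ℤ_[p] (ZMod (q p))ˣ) i) x).trans ?_
  exact forall_congr' fun n => natCast_pow_dvd_iff _ _

lemma coord_injective : Function.Injective (coord (p := p)) := by
  intro x y h
  refine PowerSeries.ext (R := MonoidAlgebra ℤ_[p] (ZMod (q p))ˣ) fun n => ?_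
  apply MonoidAlgebra.coeff_injective
  ext1 g
  exact congrFun (congrFun h n) g

lemma coord_surjective : Function.Surjective (coord (p := p)) := by
  intro c
  refine ⟨ofSeries (PowerSeries.mk fun n => MonoidAlgebra.ofCoeff (Finsupp.equivFunOnFinite.symm (c n))),
    ?_⟩
  funext n g
  rw [coord_mk]
  rfl

lemma coord_algebraMap_mul (c : ℤ_[p]) (x : Iwasawa p) (n : ℕ) (g : (ZMod (q p))ˣ) :
    coord (algebraMap ℤ_[p] (Iwasawa p) c * x) n g = c * coord x n g := by
  have h : algebraMap ℤ_[p] (Iwasawa p) c * x = c • x := (Algebra.smul_def c x).symm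
  rw [h]
  rfl

lemma algebraMap_mem_mLambda_pow {c : ℤ_[p]} {k : ℕ} (h : (p : ℤ_[p]) ^ k ∣ c) :
    algebraMap ℤ_[p] (Iwasawa p) c ∈ mLambda p ^ k := by
  obtain ⟨d, rfl⟩ := h
  rw [map_mul, map_pow, map_natCast]
  exact Ideal.mul_mem_right _ _ (Ideal.pow_mem_pow (Ideal.subset_span (by simp)) k)

lemma hasBasis_nhds_zero : (𝓝 (0 : Iwasawa p)).HasBasis (fun _ : ℕ => True)
    fun n => ((mLambda p ^ n : Ideal (Iwasawa p)) : Set (Iwasawa p)) :=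
  (mLambda p).hasBasis_nhds_zero_adic

lemma isOpen_pow_dvd (k : ℕ) : IsOpen {c : ℤ_[p] | (p : ℤ_[p]) ^ k ∣ c} := by
  have h : {c : ℤ_[p] | (p : ℤ_[p]) ^ k ∣ c} = Metric.ball 0 ((p : ℝ) ^ (-k + 1 : ℤ)) := by
    ext c
    rw [Set.mem_ofPred_eq, ← Ideal.mem_span_singleton, ← PadicInt.norm_le_pow_iff_mem_span_pow,
      PadicInt.norm_le_pow_iff_norm_lt_pow_add_one, mem_ball_zero_iff]
  rw [h]
  exact Metric.isOpen_ball

lemma exists_pow_dvd_subset {U : Set ℤ_[p]} (hU : U ∈ 𝓝 0) :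
    ∃ k : ℕ, ∀ c : ℤ_[p], (p : ℤ_[p]) ^ k ∣ c → c ∈ U := by
  obtain ⟨ε, hε, h⟩ := Metric.mem_nhds_iff.1 hU
  obtain ⟨k, hk⟩ := PadicInt.exists_pow_neg_lt p hε
  refine ⟨k, fun c hc => h ?_⟩
  rw [mem_ball_zero_iff]
  refine lt_of_le_of_lt ?_ hk
  rw [PadicInt.norm_le_pow_iff_mem_span_pow, Ideal.mem_span_singleton]
  exact hc

/-- The `𝔪_Λ`-adic topology is the product topology of the coordinates. -/
lemma isInducing_coord : IsInducing (coord (p := p)) := by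
  rw [IsTopologicalAddGroup.isInducing_iff_nhds_zero]
  apply le_antisymm
  · rw [← tendsto_iff_comap, ← map_zero (coord (p := p))]
    rw [tendsto_pi_nhds]
    intro n
    rw [tendsto_pi_nhds]
    intro g
    rw [map_zero]
    intro U hU
    obtain ⟨k, hk⟩ := exists_pow_dvd_subset hU
    refine mem_map.2 (hasBasis_nhds_zero.mem_iff.2 ⟨n + k, trivial, fun x hx => ?_⟩)
    have := mem_mLambda_pow.1 hx n g
    rw [Nat.add_sub_cancel_left] at this
    exact hk _ this
  · refine (hasBasis_nhds_zero.ge_iff).2 fun i _ => ?_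
    have : (⋂ n ∈ Finset.range i, ⋂ g : (ZMod (q p))ˣ,
        {c : ℕ → (ZMod (q p))ˣ → ℤ_[p] | (p : ℤ_[p]) ^ (i - n) ∣ c n g}) ∈ 𝓝 0 := by
      rw [Filter.biInter_finset_mem]
      intro n _
      rw [Filter.iInter_mem]
      intro g
      have hc : Continuous fun c : ℕ → (ZMod (q p))ˣ → ℤ_[p] => c n g := continuous_apply_apply n g
      exact IsOpen.mem_nhds ((isOpen_pow_dvd (p := p) (i - n)).preimage hc) (by simp)
    refine ⟨_, this, fun x hx => ?_⟩
    refine mem_mLambda_pow.2 fun n g => ?_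
    by_cases hn : n < i
    · simp only [Set.mem_preimage, Set.mem_iInter, Finset.mem_range, Set.mem_ofPred_eq] at hx
      exact hx n hn g
    · simp [Nat.sub_eq_zero_of_le (not_lt.1 hn)]

instance : T2Space (Iwasawa p) :=
  T2Space.of_injective_continuous coord_injective isInducing_coord.continuous

lemma isClosed_mLambda_pow (k : ℕ) :
    IsClosed ((mLambda p ^ k : Ideal (Iwasawa p)) : Set (Iwasawa p)) := by
  refine AddSubgroup.isClosed_of_isOpen (mLambda p ^ k).toAddSubgroup ?_
  refine AddSubgroup.isOpen_of_mem_nhds _ (g := 0) ?_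
  exact hasBasis_nhds_zero.mem_of_mem (i := k) trivial

lemma tendsto_iwasawa_iff {α : Type*} {l : Filter α} {u : α → Iwasawa p} {a : Iwasawa p} :
    Tendsto u l (𝓝 a) ↔ ∀ k, ∀ᶠ n in l, u n - a ∈ mLambda p ^ k := by
  rw [← tendsto_sub_nhds_zero_iff, hasBasis_nhds_zero.tendsto_right_iff]
  simp

lemma continuous_of_forall_sub_mem {f : ℤ_[p] → Iwasawa p}
    (h : ∀ k, ∃ N : ℕ, ∀ z w, (p : ℤ_[p]) ^ N ∣ w - z → f w - f z ∈ mLambda p ^ k) :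
    Continuous f := by
  rw [continuous_iff_continuousAt]
  intro z
  rw [ContinuousAt, tendsto_iwasawa_iff]
  intro k
  obtain ⟨N, hN⟩ := h k
  have h1 : IsOpen {w : ℤ_[p] | (p : ℤ_[p]) ^ N ∣ w - z} :=
    (isOpen_pow_dvd N).preimage (continuous_id.sub continuous_const)
  filter_upwards [h1.mem_nhds (by simp)] with w hw
  exact hN z w hw

/-- Completeness of $\Lambda$, checked on coordinates in $\mathbb Z_p$, where by the ultrametric
inequality null successive differences make a sequence Cauchy. -/
lemma exists_limit_of_sub_mem (u : ℕ → Iwasawa p)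
    (h : Tendsto (fun n => u (n + 1) - u n) atTop (𝓝 0)) : ∃ a, Tendsto u atTop (𝓝 a) := by
  have h1 : ∀ n g, ∃ a : ℤ_[p], Tendsto (fun m => coord (u m) n g) atTop (𝓝 a) := by
    intro n g
    refine cauchySeq_tendsto_of_complete ?_
    refine NonarchimedeanAddGroup.cauchySeq_of_tendsto_sub_nhds_zero ?_
    have h2 := (isInducing_coord (p := p)).continuous.tendsto 0 |>.comp h
    rw [map_zero, tendsto_pi_nhds] at h2
    have h3 := h2 n
    rw [tendsto_pi_nhds] at h3
    simpa only [Function.comp_apply, map_sub, Pi.sub_apply, Pi.zero_apply] using h3 g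
  choose a ha using h1
  obtain ⟨b, hb⟩ := coord_surjective a
  refine ⟨b, ?_⟩
  rw [isInducing_coord.tendsto_nhds_iff, hb, tendsto_pi_nhds]
  intro n
  rw [tendsto_pi_nhds]
  exact fun g => ha n g

lemma coord_fwdDiff_iter (f : ℤ_[p] → Iwasawa p) (k n : ℕ) (g : (ZMod (q p))ˣ) (z : ℤ_[p]) :
    coord ((fwdDiff 1)^[k] f z) n g = (fwdDiff 1)^[k] (fun w => coord (f w) n g) z := by
  rw [fwdDiff_iter_eq_sum_shift, fwdDiff_iter_eq_sum_shift, map_sum, Finset.sum_apply,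
    Finset.sum_apply]
  refine Finset.sum_congr rfl fun i _ => ?_
  rw [map_zsmul]
  rfl

/-- Mahler's theorem for functions with values in the Iwasawa algebra. -/
lemma hasSum_mahler_iwasawa {f : ℤ_[p] → Iwasawa p} (hf : Continuous f) :
    Tendsto (fun k => (fwdDiff 1)^[k] f 0) atTop (𝓝 0) ∧
    ∀ z, HasSum (fun k => (fwdDiff 1)^[k] f 0 * algebraMap ℤ_[p] (Iwasawa p) (Ring.choose z k))
      (f z) := by
  have hc : ∀ n g, Continuous fun z => coord (f z) n g := fun n g =>
    (continuous_apply g).comp ((continuous_apply n).comp (isInducing_coord.continuous.comp hf))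
  constructor
  · rw [isInducing_coord.tendsto_nhds_iff, map_zero, tendsto_pi_nhds]
    intro n
    rw [tendsto_pi_nhds]
    intro g
    refine Tendsto.congr (fun k => ?_) (PadicInt.fwdDiff_tendsto_zero ⟨_, hc n g⟩)
    exact (coord_fwdDiff_iter f k n g 0).symm
  · intro z
    rw [HasSum, isInducing_coord.tendsto_nhds_iff, tendsto_pi_nhds]
    intro n
    rw [tendsto_pi_nhds]
    intro g
    have h1 := (PadicInt.hasSum_mahler (⟨_, hc n g⟩ : C(ℤ_[p], ℤ_[p])))
    have h2 := (ContinuousEvalConst.continuous_eval_const z).tendsto _ |>.comp h1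
    refine Tendsto.congr (fun s => ?_) h2
    rw [Function.comp_apply, ContinuousMap.coe_sum, Finset.sum_apply, Function.comp_apply,
      map_sum, Finset.sum_apply, Finset.sum_apply]
    refine Finset.sum_congr rfl fun k _ => ?_
    rw [mul_comm _ (algebraMap _ _ _), coord_algebraMap_mul, coord_fwdDiff_iter]
    rfl

/-- Here $[a]=(1+T)^s$ with $p^k\mid s$. For $r\ge1$ the coefficient of $T^r$ is divisible by
$p^{k-v(r)}$, and $v(r)<r$ gives $k-v(r)\ge k+1-r$. -/
lemma univChar_sub_one_mem (a : ℤ_[p]ˣ) (k : ℕ)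
    (ha : (p : ℤ_[p]) ^ k * (q p : ℕ) ∣ (a : ℤ_[p]) - 1) :
    univChar a - 1 ∈ mLambda p ^ (k + 1) := by
  have h0 : unitClass a = 1 := unitClass_eq_one a ((Dvd.intro_left _ rfl).trans ha)
  have h1 : (univChar a - 1 : Iwasawa p) =
      ofSeries (PowerSeries.mk fun r =>
        MonoidAlgebra.single 1 (Ring.choose (unitLog a) r) - if r = 0 then 1 else 0) := by
    refine PowerSeries.ext (R := MonoidAlgebra ℤ_[p] (ZMod (q p))ˣ) fun r => ?_
    rw [← h0]
    refine (map_sub (PowerSeries.coeff r) _ _).trans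
      (Eq.trans ?_ (PowerSeries.coeff_mk r _).symm)
    congr 1
    · rw [univChar, PowerSeries.coeff_mk]
    · exact PowerSeries.coeff_one r
  rw [mem_mLambda_pow]
  intro n g
  rw [h1, coord_mk]
  rcases eq_or_ne n 0 with rfl | hn
  · rw [Ring.choose_zero_right, if_pos rfl, MonoidAlgebra.one_def, sub_self]
    simp
  · rw [if_neg hn, sub_zero, MonoidAlgebra.coeff_single, Finsupp.single_apply]
    split_ifs
    · refine (pow_dvd_pow _ ?_).trans (prime_pow_dvd_choose _ k n (dvd_unitLog a k ha) hn)
      have h2 : padicValNat p n < n :=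
        (padicValNat_le_nat_log n).trans_lt (Nat.log_lt_self p hn)
      omega
    · exact dvd_zero _

end IwasawaTopology

/-! ### The monoid `M₁` and its action -/

section Monoid

open Filter Topology

variable {p : ℕ} [Fact p.Prime]

/-- The monoid `M₁` of matrices `(a b; c d)` with `q ∣ c` and `d` a unit. -/
def IsM1 (δ : Matrix (Fin 2) (Fin 2) ℤ_[p]) : Prop :=
  ((q p : ℕ) : ℤ_[p]) ∣ δ 1 0 ∧ IsUnit (δ 1 1)

lemma isUnit_iff_not_dvd (x : ℤ_[p]) : IsUnit x ↔ ¬ (p : ℤ_[p]) ∣ x := by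
  rw [← PadicInt.norm_lt_one_iff_dvd, PadicInt.isUnit_iff, not_lt]
  exact ⟨fun h => h.ge, fun h => le_antisymm (PadicInt.norm_le_one x) h⟩

lemma prime_dvd_q : (p : ℤ_[p]) ∣ ((q p : ℕ) : ℤ_[p]) := by
  rw [q, Nat.cast_pow]
  exact dvd_pow_self _ (qExp_pos (p := p)).ne'

lemma IsM1.isUnit_den {δ : Matrix (Fin 2) (Fin 2) ℤ_[p]} (hδ : IsM1 δ) (z : ℤ_[p]) :
    IsUnit (δ 1 0 * z + δ 1 1) := by
  have h2 := hδ.2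
  rw [isUnit_iff_not_dvd] at h2 ⊢
  exact fun h => h2 ((dvd_add_right ((prime_dvd_q.trans hδ.1).mul_right z)).1 h)

/-- The value `c z + d` as a unit. -/
def IsM1.den {δ : Matrix (Fin 2) (Fin 2) ℤ_[p]} (hδ : IsM1 δ) (z : ℤ_[p]) : ℤ_[p]ˣ :=
  (hδ.isUnit_den z).unit

lemma IsM1.val_den {δ : Matrix (Fin 2) (Fin 2) ℤ_[p]} (hδ : IsM1 δ) (z : ℤ_[p]) :
    (hδ.den z : ℤ_[p]) = δ 1 0 * z + δ 1 1 := rfl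

/-- The value `(a z + b) / (c z + d)`. -/
def IsM1.moeb {δ : Matrix (Fin 2) (Fin 2) ℤ_[p]} (hδ : IsM1 δ) (z : ℤ_[p]) : ℤ_[p] :=
  (δ 0 0 * z + δ 0 1) * ((hδ.den z)⁻¹ : ℤ_[p]ˣ)

lemma slash_apply {δ : Matrix (Fin 2) (Fin 2) ℤ_[p]} (hδ : IsM1 δ) (h : ℤ_[p] → Iwasawa p)
    (z : ℤ_[p]) : slash δ h z = univChar (hδ.den z) * h (hδ.moeb z) := by
  simp only [slash, LinearMap.coe_mk, AddHom.coe_mk, dif_pos (hδ.isUnit_den z)]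
  rfl

lemma IsM1.mul {δ ε : Matrix (Fin 2) (Fin 2) ℤ_[p]} (hδ : IsM1 δ) (hε : IsM1 ε) :
    IsM1 (δ * ε) := by
  simp only [IsM1, Matrix.mul_apply, Fin.sum_univ_two] at *
  refine ⟨dvd_add (hδ.1.mul_right _) (hε.1.mul_left _), ?_⟩
  have h2 : IsUnit (δ 1 1 * ε 1 1) := hδ.2.mul hε.2
  rw [isUnit_iff_not_dvd] at h2 ⊢
  exact fun h => h2 ((dvd_add_right ((prime_dvd_q.trans hδ.1).mul_right _)).1 h)

/-- The cocycle relation for $cz+d$ combined with multiplicativity of $[-]$. -/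
lemma slash_mul {δ ε : Matrix (Fin 2) (Fin 2) ℤ_[p]} (hδ : IsM1 δ) (hε : IsM1 ε)
    (h : ℤ_[p] → Iwasawa p) : slash (δ * ε) h = slash ε (slash δ h) := by
  funext z
  rw [slash_apply (hδ.mul hε), slash_apply hε, slash_apply hδ, ← mul_assoc, ← univChar_mul]
  have h0 : (hε.den z : ℤ_[p]) * ((hε.den z)⁻¹ : ℤ_[p]ˣ) = 1 := Units.mul_inv _
  have h1 : (hδ.mul hε).den z = hε.den z * hδ.den (hε.moeb z) := by
    apply Units.ext
    rw [Units.val_mul, IsM1.val_den, IsM1.val_den hδ, IsM1.moeb]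
    have h2 := hε.val_den z
    simp only [Matrix.mul_apply, Fin.sum_univ_two] at *
    linear_combination (-(δ 1 1)) * h2 - δ 1 0 * (ε 0 0 * z + ε 0 1) * h0
  have h3 : (hδ.mul hε).moeb z = hδ.moeb (hε.moeb z) := by
    rw [IsM1.moeb, IsM1.moeb, h1, mul_inv, Units.val_mul, ← mul_assoc]
    congr 1
    rw [IsM1.moeb]
    have h2 := hε.val_den z
    simp only [Matrix.mul_apply, Fin.sum_univ_two] at *
    linear_combination (δ 0 1) * h0 - δ 0 1 * ((hε.den z)⁻¹ : ℤ_[p]ˣ) * h2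
  rw [h1, h3]

lemma isM1_one : IsM1 (1 : Matrix (Fin 2) (Fin 2) ℤ_[p]) := by
  simp [IsM1]

lemma slash_one (h : ℤ_[p] → Iwasawa p) : slash 1 h = h := by
  funext z
  rw [slash_apply isM1_one]
  have h1 : (isM1_one (p := p)).den z = 1 := Units.ext (by simp [IsM1.val_den])
  rw [IsM1.moeb, h1, univChar_one]
  simp

lemma isM1_of_mem_iwahori {u : GL (Fin 2) ℤ_[p]} (hu : u ∈ iwahori p) :
    IsM1 (u : Matrix (Fin 2) (Fin 2) ℤ_[p]) := by
  have h1 : ((q p : ℕ) : ℤ_[p]) ∣ (u : Matrix (Fin 2) (Fin 2) ℤ_[p]) 1 0 := hu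
  refine ⟨h1, ?_⟩
  have h2 : IsUnit (u : Matrix (Fin 2) (Fin 2) ℤ_[p]).det :=
    (Matrix.isUnit_iff_isUnit_det _).1 u.isUnit
  rw [Matrix.det_fin_two] at h2
  rw [isUnit_iff_not_dvd] at h2 ⊢
  exact fun h => h2 (dvd_sub (h.mul_left _) ((prime_dvd_q.trans h1).mul_left _))

lemma isM1_vMat (j : ℕ) : IsM1 (vMat p j) := by
  simp [IsM1, vMat]

lemma continuous_slash {δ : Matrix (Fin 2) (Fin 2) ℤ_[p]} (hδ : IsM1 δ)
    {h : ℤ_[p] → Iwasawa p} (hh : Continuous h) : Continuous (slash δ h) := by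
  have h0 : slash δ h = fun z => univChar (hδ.den z) * h (hδ.moeb z) :=
    funext fun z => slash_apply hδ h z
  rw [h0]
  refine Continuous.mul ?_ (hh.comp ?_)
  -- $[cw+d]-[cz+d]=[cz+d]([\rho]-1)$ with $\rho-1$ a multiple of $w-z$; the exponent is chosen so
  -- that $p^kq$ divides $w-z$.
  · refine continuous_of_forall_sub_mem fun k => ⟨k + qExp p, fun z w hzw => ?_⟩
    have h1 : hδ.den w = hδ.den z * ((hδ.den z)⁻¹ * hδ.den w) := by group
    rw [h1, univChar_mul]
    have h2 : univChar (hδ.den z) * univChar ((hδ.den z)⁻¹ * hδ.den w) - univChar (hδ.den z) =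
        univChar (hδ.den z) * (univChar ((hδ.den z)⁻¹ * hδ.den w) - 1) := by ring
    rw [h2]
    refine Ideal.mul_mem_left _ _ (Ideal.pow_le_pow_right (Nat.le_succ k)
      (univChar_sub_one_mem _ k ?_))
    have h3 : (((hδ.den z)⁻¹ * hδ.den w : ℤ_[p]ˣ) : ℤ_[p]) - 1 =
        (w - z) * (((hδ.den z)⁻¹ : ℤ_[p]ˣ) * δ 1 0) := by
      have h4 : ((hδ.den z)⁻¹ : ℤ_[p]ˣ) * (hδ.den z : ℤ_[p]) = 1 := Units.inv_mul _
      rw [Units.val_mul]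
      rw [hδ.val_den z] at h4
      rw [hδ.val_den w]
      linear_combination h4
    rw [h3]
    refine Dvd.dvd.mul_right ?_ _
    rw [q, Nat.cast_pow, ← pow_add]
    exact hzw
  · refine Continuous.mul (by fun_prop) ?_
    refine (LipschitzWith.of_dist_le_mul (K := 1) fun z w => ?_).continuous
    have h3 : (((hδ.den z)⁻¹ : ℤ_[p]ˣ) : ℤ_[p]) - ((hδ.den w)⁻¹ : ℤ_[p]ˣ) =
        (((hδ.den z)⁻¹ : ℤ_[p]ˣ) * ((hδ.den w)⁻¹ : ℤ_[p]ˣ) * (-δ 1 0)) * (z - w) := by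
      have h4 : ((hδ.den z)⁻¹ : ℤ_[p]ˣ) * (hδ.den z : ℤ_[p]) = 1 := Units.inv_mul _
      have h5 : ((hδ.den w)⁻¹ : ℤ_[p]ˣ) * (hδ.den w : ℤ_[p]) = 1 := Units.inv_mul _
      rw [hδ.val_den z] at h4
      rw [hδ.val_den w] at h5
      linear_combination (((hδ.den w)⁻¹ : ℤ_[p]ˣ) : ℤ_[p]) * h4 -
        (((hδ.den z)⁻¹ : ℤ_[p]ˣ) : ℤ_[p]) * h5
    rw [dist_eq_norm, dist_eq_norm, h3, norm_mul, NNReal.coe_one]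
    exact mul_le_mul_of_nonneg_right (PadicInt.norm_le_one _) (norm_nonneg _)

end Monoid

/-! ### Estimates for Mahler coefficients -/

section Estimates

variable {p : ℕ} [Fact p.Prime]

lemma mem_span_prime_pow {k : ℕ} {x : ℤ_[p]} :
    x ∈ Ideal.span {(p : ℤ_[p])} ^ k ↔ (p : ℤ_[p]) ^ k ∣ x := by
  rw [Ideal.span_singleton_pow, Ideal.mem_span_singleton]

lemma diffFiltered_linear (a b : ℤ_[p]) (ha : (p : ℤ_[p]) ∣ a) :
    DiffFiltered (1 : ℤ_[p]) (fun k => Ideal.span {(p : ℤ_[p])} ^ k) (fun z => a * z + b) := by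
  intro m z
  rcases m with _ | m
  · simp
  have h1 : fwdDiff (1 : ℤ_[p]) (fun z => a * z + b) = fun _ => a := by
    funext z
    simp only [fwdDiff]
    ring
  rw [Function.iterate_succ_apply, h1]
  rcases eq_or_ne m 0 with rfl | hm
  · simpa [Ideal.mem_span_singleton] using ha
  · rw [fwdDiff_iter_const _ _ _ hm]
    exact zero_mem _

lemma IsM1.diffFiltered_den_inv {δ : Matrix (Fin 2) (Fin 2) ℤ_[p]} (hδ : IsM1 δ) :
    DiffFiltered (1 : ℤ_[p]) (fun k => Ideal.span {(p : ℤ_[p])} ^ k)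
      (fun z => (((hδ.den z)⁻¹ : ℤ_[p]ˣ) : ℤ_[p])) :=
  (diffFiltered_linear (δ 1 0) (δ 1 1) (prime_dvd_q.trans hδ.1)).inv (isFiltration_pow _)
    fun z => (hδ.den z).mul_inv

lemma IsM1.diffFiltered_moeb {δ : Matrix (Fin 2) (Fin 2) ℤ_[p]} (hδ : IsM1 δ)
    (ha : (p : ℤ_[p]) ∣ δ 0 0) :
    DiffFiltered (1 : ℤ_[p]) (fun k => Ideal.span {(p : ℤ_[p])} ^ k) hδ.moeb :=
  (diffFiltered_linear (δ 0 0) (δ 0 1) ha).mul (isFiltration_pow _) hδ.diffFiltered_den_inv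

/-- Taking a difference gains one power of $p$, dividing by $p$ gives it back, so $\Delta r/p$ is
again filtered. -/
lemma exists_fwdDiff_eq_mul {r : ℤ_[p] → ℤ_[p]}
    (hr : DiffFiltered (1 : ℤ_[p]) (fun k => Ideal.span {(p : ℤ_[p])} ^ k) r) :
    ∃ s, DiffFiltered (1 : ℤ_[p]) (fun k => Ideal.span {(p : ℤ_[p])} ^ k) s ∧
      ∀ z, r (z + 1) - r z = p * s z := by
  have hp0 : (p : ℤ_[p]) ≠ 0 := by exact_mod_cast (Fact.out : p.Prime).ne_zero
  have h1 : ∀ z, ∃ s, r (z + 1) - r z = p * s := fun z => by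
    have h2 : fwdDiff 1 r z ∈ Ideal.span {(p : ℤ_[p])} := by simpa using hr 1 z
    exact Ideal.mem_span_singleton.1 h2
  choose s hs using h1
  refine ⟨s, fun m z => ?_, hs⟩
  have h2 := hr (m + 1) z
  have h3 : fwdDiff (1 : ℤ_[p]) r = (p : ℤ_[p]) • s := funext hs
  rw [Function.iterate_succ_apply, h3, fwdDiff_iter_const_smul] at h2
  simp only [mem_span_prime_pow, Pi.smul_apply, smul_eq_mul] at h2 ⊢
  rw [pow_succ'] at h2
  exact (mul_dvd_mul_iff_left hp0).1 h2

/-- The iterated multiplicative differences of a function with values in a group. -/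
def mulDiff (U : ℤ_[p] → ℤ_[p]ˣ) : ℕ → ℤ_[p] → ℤ_[p]ˣ
  | 0 => U
  | k + 1 => fun z => mulDiff U k (z + 1) * (mulDiff U k z)⁻¹

/-- If $V=1+p^kq\,r$, then $V(z+1)/V(z)=1+p^kq\,\Delta r(z)/V(z)$, and $\Delta r$ is divisible by
$p$. The induction needs the filtration property of the new remainder as well, hence its presence in
the statement. -/
lemma IsM1.exists_mulDiff_den {δ : Matrix (Fin 2) (Fin 2) ℤ_[p]} (hδ : IsM1 δ) (k : ℕ) :
    ∃ r, DiffFiltered (1 : ℤ_[p]) (fun k => Ideal.span {(p : ℤ_[p])} ^ k) r ∧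
      ∀ z, (mulDiff hδ.den (k + 1) z : ℤ_[p]) = 1 + (p : ℤ_[p]) ^ k * (q p : ℕ) * r z := by
  have hF := isFiltration_pow (Ideal.span {(p : ℤ_[p])})
  induction k with
  | zero =>
    obtain ⟨c, hc⟩ := hδ.1
    refine ⟨_, (diffFiltered_const 1 hF c).mul hF hδ.diffFiltered_den_inv, fun z => ?_⟩
    simp only [mulDiff, Pi.mul_apply]
    have h4 : (hδ.den z : ℤ_[p]) * ((hδ.den z)⁻¹ : ℤ_[p]ˣ) = 1 := Units.mul_inv _
    rw [Units.val_mul, hδ.val_den (z + 1)]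
    rw [hδ.val_den z] at h4
    linear_combination h4 + (((hδ.den z)⁻¹ : ℤ_[p]ˣ) : ℤ_[p]) * hc
  | succ k ih =>
    obtain ⟨r, hr, h1⟩ := ih
    obtain ⟨s, hs, h2⟩ := exists_fwdDiff_eq_mul hr
    set V := mulDiff hδ.den (k + 1) with hV
    have h3 : DiffFiltered (1 : ℤ_[p]) (fun k => Ideal.span {(p : ℤ_[p])} ^ k)
        (fun z => (((V z)⁻¹ : ℤ_[p]ˣ) : ℤ_[p])) := by
      refine ((diffFiltered_const 1 hF 1).add
        ((diffFiltered_const 1 hF ((p : ℤ_[p]) ^ k * (q p : ℕ))).mul hF hr)).inv hF fun z => ?_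
      have : (V z : ℤ_[p]) * ((V z)⁻¹ : ℤ_[p]ˣ) = 1 := Units.mul_inv _
      rw [h1] at this
      exact this
    refine ⟨_, hs.mul hF h3, fun z => ?_⟩
    change ((V (z + 1) * (V z)⁻¹ : ℤ_[p]ˣ) : ℤ_[p]) = _
    have h4 : (V z : ℤ_[p]) * ((V z)⁻¹ : ℤ_[p]ˣ) = 1 := Units.mul_inv _
    rw [Units.val_mul, h1 (z + 1), Pi.mul_apply]
    rw [h1 z] at h4
    linear_combination h4 + (((V z)⁻¹ : ℤ_[p]ˣ) : ℤ_[p]) * (p : ℤ_[p]) ^ k * (q p : ℕ) * h2 z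

lemma IsM1.diffFiltered_univChar {δ : Matrix (Fin 2) (Fin 2) ℤ_[p]} (hδ : IsM1 δ) :
    DiffFiltered (1 : ℤ_[p]) (fun k => mLambda p ^ k) (fun z => univChar (hδ.den z)) := by
  refine diffFiltered_of_mulDiff (isFiltration_pow _)
    (fun k z => univChar (mulDiff hδ.den k z)) (fun k z => ?_) (fun k z => ?_)
  · rw [← univChar_mul, mulDiff, mul_comm, inv_mul_cancel_right]
  · rcases k with _ | k
    · simp
    obtain ⟨r, -, hr⟩ := hδ.exists_mulDiff_den k
    refine univChar_sub_one_mem _ k ?_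
    rw [hr z, add_sub_cancel_left]
    exact dvd_mul_right _ _

/-- Replaces the valuation by $\lfloor n/p\rfloor$, which is superadditive and hence an admissible
weight for `weightIdeal`. -/
lemma padicValNat_le_div (n : ℕ) : padicValNat p n ≤ n / p := by
  have hp : p.Prime := Fact.out
  rcases eq_or_ne n 0 with rfl | hn
  · simp
  rcases Nat.eq_zero_or_pos (padicValNat p n) with h | h
  · exact h ▸ Nat.zero_le _
  rw [Nat.le_div_iff_mul_le hp.pos]
  obtain ⟨e, he⟩ := Nat.exists_eq_succ_of_ne_zero h.ne'
  have h1 : p ^ padicValNat p n ≤ n := Nat.le_of_dvd (Nat.pos_of_ne_zero hn) pow_padicValNat_dvd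
  refine le_trans ?_ h1
  rw [he, pow_succ]
  exact Nat.mul_le_mul_right p (Nat.lt_pow_self hp.one_lt)

/-- All `n` are handled at once through $(1+X)^{h(z)}$: its multiplicative differences are
$(1+X)^{\Delta^kh(z)}$, and the weight $\lfloor n/p\rfloor$ absorbs the denominators $v(n)$. -/
lemma pow_dvd_fwdDiff_choose {h : ℤ_[p] → ℤ_[p]}
    (hh : DiffFiltered (1 : ℤ_[p]) (fun k => Ideal.span {(p : ℤ_[p])} ^ k) h) (n m : ℕ)
    (z : ℤ_[p]) :
    (p : ℤ_[p]) ^ (m - n / p) ∣ (fwdDiff 1)^[m] (fun z => Ring.choose (h z) n) z := by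
  have hw : ∀ a b : ℕ, a / p + b / p ≤ (a + b) / p := fun a b => Nat.div_add_div_le_add_div
  have hF := isFiltration_weightIdeal (p : ℤ_[p]) (· / p) hw
  have key := diffFiltered_of_mulDiff (h := (1 : ℤ_[p])) hF
    (fun k z => PowerSeries.binomialSeries ℤ_[p] ((fwdDiff 1)^[k] h z)) (fun k z => ?_)
    (fun k z => ?_) m z n
  · rw [fwdDiff_iter_eq_sum_shift] at key ⊢
    simpa only [map_sum, map_zsmul, PowerSeries.binomialSeries_coeff, smul_eq_mul, mul_one,
      Function.iterate_zero, id_eq] using key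
  · rw [← PowerSeries.binomialSeries_add, Function.iterate_succ_apply', fwdDiff,
      add_sub_cancel]
  · rcases k with _ | k
    · simp [hF.zero]
    intro r
    rcases eq_or_ne r 0 with rfl | hr
    · simp
    · have h1 : PowerSeries.coeff r (1 : PowerSeries ℤ_[p]) = 0 := by
        rw [PowerSeries.coeff_one, if_neg hr]
      rw [map_sub, h1, sub_zero, PowerSeries.binomialSeries_coeff, smul_eq_mul, mul_one]
      refine (pow_dvd_pow _ ?_).trans
        (prime_pow_dvd_choose _ (k + 1) r (mem_span_prime_pow.1 (hh (k + 1) z)) hr)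
      have := padicValNat_le_div (p := p) r
      simp only
      omega

/-- The Mahler coefficients of `(z choose n) ‖ δ` for `δ` with upper left entry divisible by `p`. -/
lemma fwdDiff_slash_choose_mem {δ : Matrix (Fin 2) (Fin 2) ℤ_[p]} (hδ : IsM1 δ)
    (ha : (p : ℤ_[p]) ∣ δ 0 0) (n m : ℕ) (z : ℤ_[p]) :
    (fwdDiff 1)^[m] (slash δ fun z => algebraMap ℤ_[p] (Iwasawa p) (Ring.choose z n)) z ∈
      mLambda p ^ (m - n / p) := by
  have h0 : (slash δ fun z => algebraMap ℤ_[p] (Iwasawa p) (Ring.choose z n)) =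
      (fun z => univChar (hδ.den z)) *
        fun z => algebraMap ℤ_[p] (Iwasawa p) (Ring.choose (hδ.moeb z) n) :=
    funext fun z => slash_apply hδ _ z
  rw [h0]
  refine fwdDiff_iter_mul_mem 1 _ m (fun i => mLambda p ^ i) (fun j => mLambda p ^ (j - n / p)) _ _
    (fun i _ => hδ.diffFiltered_univChar i) (fun i _ w => ?_) (fun i j hij => ?_) z
  · have h1 := algebraMap_mem_mLambda_pow
      (pow_dvd_fwdDiff_choose (hδ.diffFiltered_moeb ha) n i w)
    rw [fwdDiff_iter_eq_sum_shift] at h1 ⊢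
    simpa [map_sum, zsmul_eq_mul] using h1
  · rw [← pow_add]
    exact Ideal.pow_le_pow_right (by omega)

end Estimates

/-! ### Automorphic forms and their values at representatives -/

section FormValues

open Filter Topology

variable {p : ℕ} [Fact p.Prime] {D : Type*} [Ring D] [Algebra ℚ D]
  {ι : ℚ_[p] ⊗[ℚ] D ≃ₐ[ℚ_[p]] Matrix (Fin 2) (Fin 2) ℚ_[p]}
  {Kp : Subgroup (TameGroup p D)} {t : ℕ} {γ : Fin t → FinGroup p D}

lemma toGLQ_injective : Function.Injective (toGLQ p) := by
  intro u v h
  apply Units.ext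
  ext i j
  have h1 := congrArg (fun g : GL (Fin 2) ℚ_[p] => (g : Matrix (Fin 2) (Fin 2) ℚ_[p]) i j) h
  exact Subtype.ext h1

lemma IsRepresentatives.exists_eq (hγ : IsRepresentatives ι Kp γ) (x : FinGroup p D) :
    ∃ (δ : Dˣ) (i : Fin t) (k : TameGroup p D) (u : GL (Fin 2) ℤ_[p]), k ∈ Kp ∧ u ∈ iwahori p ∧
      x = diag ι δ * γ i * (k, toGLQ p u) := by
  obtain ⟨i, hi⟩ := hγ.1.2 (DoubleCoset.mk _ _ x)
  obtain ⟨_, ⟨δ, rfl⟩, ⟨k, w⟩, hkw, h⟩ := (DoubleCoset.eq _ _ _ _).1 hi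
  obtain ⟨hk, u, hu, rfl⟩ := Subgroup.mem_prod.1 hkw
  exact ⟨δ, i, k, u, hk, hu, h⟩

/-- Equal double cosets force $i=i'$. Then $\gamma_i^{-1}\delta'^{-1}\delta\gamma_i$ lies in the
level, so neatness makes it trivial, which identifies the level components. -/
lemma IsRepresentatives.eq_of_eq (hγ : IsRepresentatives ι Kp γ) (hneat : IsNeat ι Kp)
    {δ δ' : Dˣ} {i i' : Fin t} {k k' : TameGroup p D} {u u' : GL (Fin 2) ℤ_[p]}
    (hk : k ∈ Kp) (hk' : k' ∈ Kp) (hu : u ∈ iwahori p) (hu' : u' ∈ iwahori p)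
    (h : diag ι δ * γ i * (k, toGLQ p u) = diag ι δ' * γ i' * (k', toGLQ p u')) :
    i = i' ∧ u = u' := by
  have hl : ((k, toGLQ p u) : FinGroup p D) ∈ level Kp := ⟨hk, u, hu, rfl⟩
  have hl' : ((k', toGLQ p u') : FinGroup p D) ∈ level Kp := ⟨hk', u', hu', rfl⟩
  have hi : i = i' := by
    apply hγ.1.1
    rw [DoubleCoset.eq]
    refine ⟨_, ⟨δ'⁻¹ * δ, rfl⟩, _, (level Kp).mul_mem hl ((level Kp).inv_mem hl'), ?_⟩
    rw [map_mul, map_inv]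
    have : γ i' = (diag ι δ')⁻¹ * (diag ι δ * γ i * (k, toGLQ p u)) * (k', toGLQ p u')⁻¹ := by
      rw [h]
      group
    rw [this]
    group
  subst hi
  refine ⟨rfl, ?_⟩
  have h1 : (γ i)⁻¹ * diag ι (δ'⁻¹ * δ) * γ i = (k', toGLQ p u') * (k, toGLQ p u)⁻¹ := by
    have : (γ i)⁻¹ * diag ι (δ'⁻¹ * δ) * γ i =
        (γ i)⁻¹ * (diag ι δ')⁻¹ * (diag ι δ * γ i * (k, toGLQ p u)) * (k, toGLQ p u)⁻¹ := by
      rw [map_mul, map_inv]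
      group
    rw [this, h]
    group
  have h2 := hneat (γ i) (δ'⁻¹ * δ) (h1 ▸ (level Kp).mul_mem hl' ((level Kp).inv_mem hl))
  rw [h1, mul_inv_eq_one] at h2
  exact (toGLQ_injective (congrArg Prod.snd h2)).symm

lemma SInt_apply {φ : FinGroup p D → ℤ_[p] → Iwasawa p} (hφ : φ ∈ SInt ι Kp) (δ : Dˣ)
    (x : FinGroup p D) {k : TameGroup p D} (hk : k ∈ Kp) {u : GL (Fin 2) ℤ_[p]}
    (hu : u ∈ iwahori p) :
    φ (diag ι δ * x * (k, toGLQ p u)) = slash (u : Matrix (Fin 2) (Fin 2) ℤ_[p]) (φ x) := by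
  have h : ((k, toGLQ p u) : FinGroup p D) = (k, 1) * (1, toGLQ p u) := by simp
  rw [h, ← mul_assoc, hφ.2.2.2 u hu, hφ.2.2.1 k hk, hφ.2.1]

/-- The function on `(D ⊗ 𝔸_f)ˣ` with prescribed values at the representatives. -/
def formOf (hγ : IsRepresentatives ι Kp γ) (F : Fin t → ℤ_[p] → Iwasawa p) :
    FinGroup p D → ℤ_[p] → Iwasawa p := fun x =>
  slash ((hγ.exists_eq x).choose_spec.choose_spec.choose_spec.choose :
    Matrix (Fin 2) (Fin 2) ℤ_[p]) (F (hγ.exists_eq x).choose_spec.choose)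

/-- The decomposition chosen in `formOf` is immaterial, because `i` and `u` are unique by neatness.
-/
lemma formOf_apply (hγ : IsRepresentatives ι Kp γ) (hneat : IsNeat ι Kp)
    (F : Fin t → ℤ_[p] → Iwasawa p) (δ : Dˣ) (i : Fin t) {k : TameGroup p D} (hk : k ∈ Kp)
    {u : GL (Fin 2) ℤ_[p]} (hu : u ∈ iwahori p) :
    formOf hγ F (diag ι δ * γ i * (k, toGLQ p u)) =
      slash (u : Matrix (Fin 2) (Fin 2) ℤ_[p]) (F i) := by
  set x := diag ι δ * γ i * (k, toGLQ p u) with hx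
  obtain ⟨hk', hu', h⟩ := (hγ.exists_eq x).choose_spec.choose_spec.choose_spec.choose_spec
  obtain ⟨h1, h2⟩ := hγ.eq_of_eq hneat hk hk' hu hu' (hx.symm.trans h)
  rw [formOf, ← h2, ← h1]

lemma formOf_rep (hγ : IsRepresentatives ι Kp γ) (hneat : IsNeat ι Kp)
    (F : Fin t → ℤ_[p] → Iwasawa p) (i : Fin t) : formOf hγ F (γ i) = F i := by
  have h := formOf_apply hγ hneat F 1 i Kp.one_mem (iwahori p).one_mem
  rw [map_one, map_one, ← Prod.one_eq_mk, one_mul, mul_one, Units.val_one, slash_one] at h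
  exact h

lemma formOf_mem (hγ : IsRepresentatives ι Kp γ) (hneat : IsNeat ι Kp)
    {F : Fin t → ℤ_[p] → Iwasawa p} (hF : ∀ i, Continuous (F i)) : formOf hγ F ∈ SInt ι Kp := by
  refine ⟨fun x => ?_, fun δ x => ?_, fun k hk x => ?_, fun u hu x => ?_⟩ <;>
    obtain ⟨δ₀, i, k₀, u₀, hk₀, hu₀, rfl⟩ := hγ.exists_eq x
  · rw [formOf_apply hγ hneat F δ₀ i hk₀ hu₀]
    exact continuous_slash (isM1_of_mem_iwahori hu₀) (hF i)
  · rw [formOf_apply hγ hneat F δ₀ i hk₀ hu₀, ← mul_assoc, ← mul_assoc, ← map_mul,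
      formOf_apply hγ hneat F _ i hk₀ hu₀]
  · have h : ((k₀, toGLQ p u₀) : FinGroup p D) * (k, 1) = (k₀ * k, toGLQ p u₀) := by simp
    rw [formOf_apply hγ hneat F δ₀ i hk₀ hu₀, mul_assoc, h,
      formOf_apply hγ hneat F _ i (Kp.mul_mem hk₀ hk) hu₀]
  · have h : ((k₀, toGLQ p u₀) : FinGroup p D) * (1, toGLQ p u) = (k₀, toGLQ p (u₀ * u)) := by
      simp
    rw [formOf_apply hγ hneat F δ₀ i hk₀ hu₀, mul_assoc, h,
      formOf_apply hγ hneat F _ i hk₀ ((iwahori p).mul_mem hu₀ hu), Units.val_mul,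
      slash_mul (isM1_of_mem_iwahori hu₀) (isM1_of_mem_iwahori hu)]

lemma continuous_algebraMap_choose (n : ℕ) :
    Continuous fun z : ℤ_[p] => algebraMap ℤ_[p] (Iwasawa p) (Ring.choose z n) := by
  have h : Continuous (algebraMap ℤ_[p] (Iwasawa p)) :=
    continuous_of_forall_sub_mem fun k => ⟨k, fun z w h => by
      rw [← map_sub]
      exact algebraMap_mem_mLambda_pow h⟩
  exact h.comp (PadicInt.continuous_choose n)

theorem existsUnique_isMahlerBasis (hγ : IsRepresentatives ι Kp γ) (hneat : IsNeat ι Kp) :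
    ∃! e : ℕ → FinGroup p D → ℤ_[p] → Iwasawa p, IsMahlerBasis ι Kp γ e := by
  let F : ℕ → Fin t → ℤ_[p] → Iwasawa p := fun n i z =>
    if (i : ℕ) = n % t then algebraMap ℤ_[p] (Iwasawa p) (Ring.choose z (n / t)) else 0
  refine ⟨fun n => formOf hγ (F n), fun n => ⟨formOf_mem hγ hneat fun i => ?_, fun i z => ?_⟩,
    fun e he => ?_⟩
  · by_cases h : (i : ℕ) = n % t
    · simpa only [F, h, if_true] using continuous_algebraMap_choose (n / t)
    · simpa only [F, h, if_false] using continuous_const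
  · change formOf hγ (F n) (γ i) z = _
    rw [formOf_rep hγ hneat]
  · funext n x
    obtain ⟨δ, i, k, u, hk, hu, rfl⟩ := hγ.exists_eq x
    rw [formOf_apply hγ hneat _ δ i hk hu, SInt_apply (he n).1 δ _ hk hu]
    congr 1
    funext z
    exact (he n).2 i z

end FormValues

/-! ### The operator `U_p` -/

section Hecke

open Filter Topology

variable {p : ℕ} [Fact p.Prime] {D : Type*} [Ring D] [Algebra ℚ D]
  {ι : ℚ_[p] ⊗[ℚ] D ≃ₐ[ℚ_[p]] Matrix (Fin 2) (Fin 2) ℚ_[p]}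
  {Kp : Subgroup (TameGroup p D)} {t : ℕ} {γ : Fin t → FinGroup p D}

lemma toZMod_eq_zero_iff (x : ℤ_[p]) : PadicInt.toZMod x = 0 ↔ (p : ℤ_[p]) ∣ x := by
  rw [← RingHom.mem_ker, PadicInt.ker_toZMod, PadicInt.maximalIdeal_eq_span_p,
    Ideal.mem_span_singleton]

lemma toZMod_ne_zero {x : ℤ_[p]} (hx : IsUnit x) : PadicInt.toZMod x ≠ 0 := by
  rw [Ne, toZMod_eq_zero_iff]
  exact (isUnit_iff_not_dvd x).1 hx

/-- Right multiplication by `u` permutes the cosets $\mathrm{Iw}_qv_j$; this makes $U_p$ preserve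
the transformation law. -/
lemma exists_iwahori_mul_vMat {u : GL (Fin 2) ℤ_[p]} (hu : u ∈ iwahori p) :
    ∃ τ : ℕ → ℕ, Set.MapsTo τ (Finset.range p) (Finset.range p) ∧
      Set.InjOn τ (Finset.range p) ∧ ∀ j, ∃ w ∈ iwahori p,
        (w : Matrix (Fin 2) (Fin 2) ℤ_[p]) * vMat p (τ j) = vMat p j * u := by
  have hp : p.Prime := Fact.out
  have hp0 : (p : ℤ_[p]) ≠ 0 := by exact_mod_cast hp.ne_zero
  have hM := isM1_of_mem_iwahori hu
  have hdet : IsUnit (u : Matrix (Fin 2) (Fin 2) ℤ_[p]).det :=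
    (Matrix.isUnit_iff_isUnit_det _).1 u.isUnit
  set m : Matrix (Fin 2) (Fin 2) ℤ_[p] := u.val with hm
  obtain ⟨c, hc⟩ := hM.1
  have ha : IsUnit (m 0 0) := by
    have h2 := hdet
    rw [Matrix.det_fin_two] at h2
    rw [isUnit_iff_not_dvd] at h2 ⊢
    exact fun h => h2 (dvd_sub (h.mul_right _) ((prime_dvd_q.trans hM.1).mul_left _))
  have hd0 := toZMod_ne_zero hM.2
  -- For $u=\begin{pmatrix}a&b\\qc&d\end{pmatrix}$, the index is $\tau(j)\equiv(ja+c)/d$ modulo $p$;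
  -- it is injective because $a$ is a unit.
  refine ⟨fun j => (PadicInt.toZMod ((j : ℤ_[p]) * m 0 0 + c) * (PadicInt.toZMod (m 1 1))⁻¹).val,
    fun j _ => by simpa using ZMod.val_lt _, fun j hj j' hj' h => ?_, fun j => ?_⟩
  · have h1 := mul_right_cancel₀ (inv_ne_zero hd0) (ZMod.val_injective p h)
    rw [map_add, map_add, add_left_inj, map_mul, map_mul] at h1
    have h2 := mul_right_cancel₀ (toZMod_ne_zero ha) h1
    rw [map_natCast, map_natCast] at h2
    have h3 := (ZMod.natCast_eq_natCast_iff' j j' p).1 h2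
    rwa [Nat.mod_eq_of_lt (by simpa using hj), Nat.mod_eq_of_lt (by simpa using hj')] at h3
  · set s : ℕ := (PadicInt.toZMod ((j : ℤ_[p]) * m 0 0 + c) * (PadicInt.toZMod (m 1 1))⁻¹).val with hs
    have h1 : (p : ℤ_[p]) ∣
        (j : ℤ_[p]) * m 0 0 + c - (s : ℤ_[p]) * ((j : ℤ_[p]) * (q p : ℕ) * m 0 1 + m 1 1) := by
      have h2 : PadicInt.toZMod ((q p : ℕ) : ℤ_[p]) = 0 := (toZMod_eq_zero_iff _).2 prime_dvd_q
      have h3 : ((s : ℕ) : ZMod p) =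
          PadicInt.toZMod ((j : ℤ_[p]) * m 0 0 + c) * (PadicInt.toZMod (m 1 1))⁻¹ := by
        rw [hs, ZMod.natCast_zmod_val]
      rw [← toZMod_eq_zero_iff, map_sub, map_mul _ (s : ℤ_[p]), map_natCast, h3,
        map_add _ (_ * _ * _), map_mul _ (_ * _), map_mul _ (j : ℤ_[p]), h2, mul_zero, zero_mul,
        zero_add, inv_mul_cancel_right₀ hd0, sub_self]
    obtain ⟨e, he⟩ := h1
    -- This is $v_juv_s^{-1}$. Integrality, and divisibility by $q$ of the lower left entry, come
    -- from the congruence defining $s$.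
    let W : Matrix (Fin 2) (Fin 2) ℤ_[p] :=
      !![m 0 0 - s * (q p : ℕ) * m 0 1, p * m 0 1; (q p : ℕ) * e, j * (q p : ℕ) * m 0 1 + m 1 1]
    have hW : W * vMat p s = vMat p j * m := by
      ext a b
      fin_cases a <;> fin_cases b <;>
        simp only [W, vMat, Matrix.mul_apply, Fin.sum_univ_two, Matrix.of_apply, Matrix.cons_val',
          Matrix.cons_val_zero, Matrix.cons_val_one, Matrix.cons_val_fin_one, Fin.zero_eta,
          Fin.mk_one, Fin.isValue]
      · ring
      · ring
      · linear_combination (-(q p : ℕ) : ℤ_[p]) * he - hc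
      · ring
    have hWd : W.det = m.det := by
      have h2 := congrArg Matrix.det hW
      rw [Matrix.det_mul, Matrix.det_mul] at h2
      have h3 : ∀ i, (vMat p i).det = p := fun i => by simp [vMat, Matrix.det_fin_two]
      rw [h3, h3, mul_comm] at h2
      exact mul_left_cancel₀ hp0 h2
    refine ⟨Matrix.GeneralLinearGroup.mk'' W (hWd ▸ hdet), ?_, hW⟩
    change ((q p : ℕ) : ℤ_[p]) ∣ W 1 0
    exact ⟨e, rfl⟩

lemma toGLQ_mul_vGL {w u : GL (Fin 2) ℤ_[p]} {i j : ℕ}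
    (h : (w : Matrix (Fin 2) (Fin 2) ℤ_[p]) * vMat p i = vMat p j * u) :
    toGLQ p w * vGL p i = vGL p j * toGLQ p u := by
  apply Units.ext
  have h1 := congrArg (fun m : Matrix (Fin 2) (Fin 2) ℤ_[p] => m.map (algebraMap ℤ_[p] ℚ_[p])) h
  simp only [Matrix.map_mul] at h1
  exact h1

/-- `U_p φ` has the same transformation behaviour as `φ`. -/
lemma Up_apply {φ : FinGroup p D → ℤ_[p] → Iwasawa p} (hφ : φ ∈ SInt ι Kp) (δ : Dˣ)
    (x : FinGroup p D) {k : TameGroup p D} (hk : k ∈ Kp) {u : GL (Fin 2) ℤ_[p]}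
    (hu : u ∈ iwahori p) :
    Up φ (diag ι δ * x * (k, toGLQ p u)) =
      slash (u : Matrix (Fin 2) (Fin 2) ℤ_[p]) (Up φ x) := by
  obtain ⟨τ, h1, h2, h3⟩ := exists_iwahori_mul_vMat hu
  rw [Up, Up, map_sum]
  symm
  refine Finset.sum_nbij τ h1 h2 (Finset.surjOn_of_injOn_of_card_le τ h1 h2 le_rfl) fun j _ => ?_
  obtain ⟨w, hw, h⟩ := h3 j
  have h4 := toGLQ_mul_vGL h
  have h5 : diag ι δ * x * (k, toGLQ p u) * (1, (vGL p (τ j))⁻¹) =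
      diag ι δ * (x * (1, (vGL p j)⁻¹)) * (k, toGLQ p w) := by
    rw [mul_assoc, mul_assoc, mul_assoc, mul_assoc]
    congr 2
    rw [Prod.mk_mul_mk, Prod.mk_mul_mk, mul_one, one_mul]
    congr 1
    rw [mul_inv_eq_iff_eq_mul, mul_assoc, h4, inv_mul_cancel_left]
  rw [h5, SInt_apply hφ δ _ hk hw, ← slash_mul (isM1_of_mem_iwahori hw) (isM1_vMat _), h,
    slash_mul (isM1_vMat _) (isM1_of_mem_iwahori hu)]

lemma continuous_Up {φ : FinGroup p D → ℤ_[p] → Iwasawa p} (hφ : φ ∈ SInt ι Kp)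
    (x : FinGroup p D) : Continuous (Up φ x) := by
  rw [Up]
  exact Finset.sum_induction _ _ (fun _ _ => Continuous.add) continuous_const
    fun j _ => continuous_slash (isM1_vMat j) (hφ.1 _)

/-- At $z=N$ the series stops at $k=N$ with last binomial $1$, so the coefficients are determined
recursively by the values at natural numbers. -/
lemma mahler_coeff_unique {a b : ℕ → Iwasawa p} {f : ℤ_[p] → Iwasawa p}
    (ha : ∀ z, HasSum (fun k => a k * algebraMap ℤ_[p] (Iwasawa p) (Ring.choose z k)) (f z))
    (hb : ∀ z, HasSum (fun k => b k * algebraMap ℤ_[p] (Iwasawa p) (Ring.choose z k)) (f z)) :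
    a = b := by
  have key : ∀ c : ℕ → Iwasawa p,
      (∀ z, HasSum (fun k => c k * algebraMap ℤ_[p] (Iwasawa p) (Ring.choose z k)) (f z)) →
      ∀ N : ℕ, c N = f N - ∑ k ∈ Finset.range N, c k * (N.choose k : ℕ) := by
    intro c hc N
    have h1 : HasSum (fun k => c k * algebraMap ℤ_[p] (Iwasawa p) (Ring.choose (N : ℤ_[p]) k))
        (∑ k ∈ Finset.range (N + 1),
          c k * algebraMap ℤ_[p] (Iwasawa p) (Ring.choose (N : ℤ_[p]) k)) := by
      refine hasSum_sum_of_ne_finset_zero fun k hk => ?_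
      rw [Finset.mem_range, not_lt] at hk
      rw [Ring.choose_natCast, Nat.choose_eq_zero_of_lt hk, Nat.cast_zero, map_zero, mul_zero]
    rw [(hc N).unique h1, Finset.sum_range_succ]
    simp [Ring.choose_natCast]
  funext N
  induction N using Nat.strong_induction_on with
  | _ N ih =>
    rw [key a ha, key b hb]
    congr 1
    exact Finset.sum_congr rfl fun k hk => by rw [ih k (Finset.mem_range.1 hk)]

lemma IsRepresentatives.pos (hγ : IsRepresentatives ι Kp γ) : 0 < t := by
  obtain ⟨i, -⟩ := hγ.1.2 (DoubleCoset.mk _ _ 1)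
  exact i.pos

/-- At $\gamma_i$ only the indices congruent to $i$ modulo $t$ survive, which turns an expansion in
the $e_m$ into a Mahler series. -/
lemma hasSum_rep_iff (ht : 0 < t) {e : ℕ → FinGroup p D → ℤ_[p] → Iwasawa p}
    (he : IsMahlerBasis ι Kp γ e) (a : ℕ → Iwasawa p) (i : Fin t) (z : ℤ_[p]) (s : Iwasawa p) :
    HasSum (fun m => a m * e m (γ i) z) s ↔
      HasSum (fun k => a (k * t + i) * algebraMap ℤ_[p] (Iwasawa p) (Ring.choose z k)) s := by
  have hinj : Function.Injective fun k : ℕ => k * t + (i : ℕ) := fun k l h =>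
    Nat.eq_of_mul_eq_mul_right ht (Nat.add_right_cancel h)
  rw [← hinj.hasSum_iff]
  · refine iff_of_eq (congrArg (fun f => HasSum f s) (funext fun k => ?_))
    have h1 : (k * t + (i : ℕ)) % t = i := by
      rw [Nat.mul_add_mod', Nat.mod_eq_of_lt i.2]
    have h2 : (k * t + (i : ℕ)) / t = k := by
      rw [mul_comm, Nat.mul_add_div ht, Nat.div_eq_of_lt i.2, add_zero]
    rw [Function.comp_apply, (he _).2, h1, h2, if_pos rfl]
  · intro m hm
    rw [(he m).2, if_neg, mul_zero]
    intro h
    exact hm ⟨m / t, by simp only [h]; exact Nat.div_add_mod' m t⟩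

theorem existsUnique_isMatrixOfUp (hγ : IsRepresentatives ι Kp γ)
    {e : ℕ → FinGroup p D → ℤ_[p] → Iwasawa p} (he : IsMahlerBasis ι Kp γ e) :
    ∃! P : ℕ → ℕ → Iwasawa p, IsMatrixOfUp e P := by
  have ht := hγ.pos
  have hM : ∀ n i, _ := fun n i => hasSum_mahler_iwasawa (continuous_Up (he n).1 (γ i))
  have hidx : ∀ (k : ℕ) (i : Fin t), (⟨(k * t + i) % t, Nat.mod_lt _ ht⟩ : Fin t) = i ∧
      (k * t + i) / t = k := fun k i =>
    ⟨Fin.ext ((Nat.mul_add_mod' k t i).trans (Nat.mod_eq_of_lt i.2)), by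
      rw [mul_comm, Nat.mul_add_div ht, Nat.div_eq_of_lt i.2, add_zero]⟩
  -- The entry is the $\lfloor m/t\rfloor$-th Mahler coefficient of $U_pe_n$ at $\gamma_{m\bmod t}$.
  -- The expansion at the representatives extends to all points since both sides transform alike.
  refine ⟨fun m n => (fwdDiff 1)^[m / t] (Up (e n) (γ ⟨m % t, Nat.mod_lt _ ht⟩)) 0,
    fun n => ⟨?_, fun x z => ?_⟩, fun P hP => ?_⟩
  · rw [tendsto_iwasawa_iff]
    intro k
    have h1 : ∀ i, ∀ᶠ m in atTop, (fwdDiff 1)^[m] (Up (e n) (γ i)) 0 - 0 ∈ mLambda p ^ k :=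
      fun i => tendsto_iwasawa_iff.1 (hM n i).1 k
    have h2 := (Nat.tendsto_div_const_atTop ht.ne').eventually (eventually_all.2 h1)
    filter_upwards [h2] with m hm
    exact hm _
  · obtain ⟨δ, i, k, u, hk, hu, rfl⟩ := hγ.exists_eq x
    have hu' := isM1_of_mem_iwahori hu
    rw [Up_apply (he n).1 δ _ hk hu, slash_apply hu']
    have h1 := (hasSum_rep_iff ht he
      (fun m => (fwdDiff 1)^[m / t] (Up (e n) (γ ⟨m % t, Nat.mod_lt _ ht⟩)) 0) i
      (hu'.moeb z) (Up (e n) (γ i) (hu'.moeb z))).2 (by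
        simpa only [hidx] using (hM n i).2 (hu'.moeb z))
    refine (h1.mul_left (univChar (hu'.den z))).congr_fun fun m => ?_
    rw [SInt_apply (he m).1 δ _ hk hu, slash_apply hu']
    ring
  · funext m n
    have h1 := mahler_coeff_unique
      (fun z => (hasSum_rep_iff ht he _ ⟨m % t, Nat.mod_lt _ ht⟩ z _).1 ((hP n).2 _ z))
      (hM n ⟨m % t, Nat.mod_lt _ ht⟩).2
    have h2 := congrFun h1 (m / t)
    simpa only [Nat.div_add_mod'] using h2

/-- Writing $xv_j^{-1}$ as $\gamma_l$ times $u$, up to $D^\times$ and $K^p$, the summand becomes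
$e_n(\gamma_l)\|_{uv_j}$. The first column of $v_j$ is divisible by $p$, so
`fwdDiff_slash_choose_mem` applies. -/
lemma Up_coeff_mem (hγ : IsRepresentatives ι Kp γ)
    {e : ℕ → FinGroup p D → ℤ_[p] → Iwasawa p} (he : IsMahlerBasis ι Kp γ e) (n k : ℕ)
    (x : FinGroup p D) (z : ℤ_[p]) :
    (fwdDiff 1)^[k] (Up (e n) x) z ∈ mLambda p ^ (k - n / t / p) := by
  rw [Up, fwdDiff_iter_finsetSum, Finset.sum_apply]
  refine Ideal.sum_mem _ fun j _ => ?_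
  obtain ⟨δ, l, k', u, hk, hu, h⟩ := hγ.exists_eq (x * (1, (vGL p j)⁻¹))
  have hu' := isM1_of_mem_iwahori hu
  rw [h, SInt_apply (he n).1 δ _ hk hu, ← slash_mul hu' (isM1_vMat j)]
  have h1 : e n (γ l) = fun z => if (l : ℕ) = n % t then
      algebraMap ℤ_[p] (Iwasawa p) (Ring.choose z (n / t)) else 0 := funext ((he n).2 l)
  rw [h1]
  by_cases hl : (l : ℕ) = n % t
  · simp only [if_pos hl]
    refine fwdDiff_slash_choose_mem (hu'.mul (isM1_vMat j)) ?_ _ _ _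
    simp only [Matrix.mul_apply, Fin.sum_univ_two, vMat, Matrix.of_apply, Matrix.cons_val',
      Matrix.cons_val_zero, Matrix.cons_val_one, Matrix.cons_val_fin_one]
    exact dvd_add (dvd_mul_left _ _) ((prime_dvd_q.mul_left _).mul_left _)
  · simp only [if_neg hl]
    have h2 : (fun _ : ℤ_[p] => (0 : Iwasawa p)) = 0 := rfl
    rw [h2, map_zero, fwdDiff_iter_eq_sum_shift]
    simp

/-- The entry `P_{m,n}` lies in `𝔪_Λ ^ (⌊m/t⌋ - ⌊n/(pt)⌋)`. -/
lemma IsMatrixOfUp.mem (hγ : IsRepresentatives ι Kp γ)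
    {e : ℕ → FinGroup p D → ℤ_[p] → Iwasawa p} (he : IsMahlerBasis ι Kp γ e)
    {P : ℕ → ℕ → Iwasawa p} (hP : IsMatrixOfUp e P) (m n : ℕ) :
    P m n ∈ mLambda p ^ (m / t - n / (p * t)) := by
  have ht := hγ.pos
  have h1 := mahler_coeff_unique
    (fun z => (hasSum_rep_iff ht he _ ⟨m % t, Nat.mod_lt _ ht⟩ z _).1 ((hP n).2 _ z))
    (hasSum_mahler_iwasawa (continuous_Up (he n).1 (γ ⟨m % t, Nat.mod_lt _ ht⟩))).2
  have h2 := congrFun h1 (m / t)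
  simp only [Nat.div_add_mod'] at h2
  rw [h2, mul_comm p t, ← Nat.div_div_eq_div_mul]
  exact Up_coeff_mem hγ he n (m / t) _ 0

end Hecke

/-! ### Determinants of matrices with weighted entries -/

section Determinants

variable {R : Type*} [CommRing R]

/-- The matrix `diag(d) - X Q`. -/
def pencil {n : ℕ} (d : Fin n → R) (Q : Fin n → Fin n → R) :
    Matrix (Fin n) (Fin n) (PowerSeries R) :=
  Matrix.of fun i j => PowerSeries.C (if i = j then d j else 0) -
    PowerSeries.X * PowerSeries.C (Q i j)

/-- In the expansion of `det (diag(d) - X Q)` only the permutations matter that fix the complement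
of the set of indices from which `Q` contributes. -/
lemma coeff_det_pencil_mem {n : ℕ} (d : Fin n → R) (Q : Fin n → Fin n → R) (j : ℕ) (K : Ideal R)
    (h : ∀ (S : Finset (Fin n)) (σ : Equiv.Perm (Fin n)), S.card = j → (∀ i ∉ S, d i ≠ 0) →
      (∀ i ∉ S, σ i = i) → ∏ i ∈ S, Q (σ i) i ∈ K) :
    PowerSeries.coeff j (pencil d Q).det ∈ K := by
  rw [Matrix.det_apply, map_sum]
  refine K.sum_mem fun σ _ => ?_
  rw [Units.smul_def, map_zsmul]
  refine zsmul_mem ?_ _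
  have h1 : ∀ i, pencil d Q (σ i) i = PowerSeries.X * PowerSeries.C (-Q (σ i) i) +
      PowerSeries.C (if σ i = i then d i else 0) := fun i => by
    rw [pencil, Matrix.of_apply, map_neg]
    ring
  simp only [h1]
  rw [Finset.prod_add, map_sum]
  refine K.sum_mem fun S _ => ?_
  rw [Finset.prod_mul_distrib, Finset.prod_const, ← map_prod, ← map_prod, mul_assoc, ← map_mul,
    mul_comm, PowerSeries.coeff_C_mul, PowerSeries.coeff_X_pow]
  split_ifs with hj
  · rw [mul_one]
    by_cases hS : ∀ i ∉ S, σ i = i ∧ d i ≠ 0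
    · refine K.mul_mem_right _ ?_
      rw [Finset.prod_neg]
      exact K.mul_mem_left _
        (h S σ hj.symm (fun i hi => (hS i hi).2) (fun i hi => (hS i hi).1))
    · push Not at hS
      obtain ⟨i, hi, hi'⟩ := hS
      have h0 : ∏ i ∈ Finset.univ \ S, (if σ i = i then d i else 0) = 0 :=
        Finset.prod_eq_zero (i := i) (by simpa using hi) (by
          split_ifs with hσ
          · exact hi' hσ
          · rfl)
      rw [h0, mul_zero]
      exact K.zero_mem
  · rw [mul_zero]
    exact K.zero_mem

/-- As `σ` permutes `S`, the sum of $a(\sigma i)$ over `S` equals that of $a(i)$; truncating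
individual differences $a(\sigma i)-b(i)$ can only raise the exponent. -/
lemma prod_mem_pow_sum {I : Ideal R} {a b : ℕ → ℕ} {P : ℕ → ℕ → R}
    (hP : ∀ m n, P m n ∈ I ^ (a m - b n)) (hab : ∀ n, b n ≤ a n) {n : ℕ} (S : Finset (Fin n))
    (σ : Equiv.Perm (Fin n)) (hσ : ∀ i ∉ S, σ i = i) :
    ∏ i ∈ S, P (σ i) i ∈ I ^ ∑ i ∈ S, (a i - b i) := by
  have h1 : ∏ i ∈ S, P (σ i) i ∈ I ^ ∑ i ∈ S, (a (σ i) - b i) := by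
    rw [← Finset.prod_pow_eq_pow_sum]
    exact Ideal.prod_mem_prod fun i _ => hP _ _
  refine Ideal.pow_le_pow_right ?_ h1
  have h2 : ∑ i ∈ S, a (σ i) = ∑ i ∈ S, a i := by
    have h3 : ∑ i, a (σ i) = ∑ i : Fin n, a i := Equiv.sum_comp σ fun i : Fin n => a i
    rw [← Finset.sum_add_sum_compl S, ← Finset.sum_add_sum_compl S fun i : Fin n => a i] at h3
    have h4 : ∑ i ∈ Sᶜ, a (σ i) = ∑ i ∈ Sᶜ, a i :=
      Finset.sum_congr rfl fun i hi => by rw [hσ i (Finset.mem_compl.1 hi)]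
    omega
  have h5 : ∑ i ∈ S, (a i - b i) + ∑ i ∈ S, b i = ∑ i ∈ S, a i := by
    rw [← Finset.sum_add_distrib]
    exact Finset.sum_congr rfl fun i _ => Nat.sub_add_cancel (hab i)
  have h6 : ∑ i ∈ S, a (σ i) ≤ ∑ i ∈ S, (a (σ i) - b i) + ∑ i ∈ S, b i := by
    rw [← Finset.sum_add_distrib]
    exact Finset.sum_le_sum fun i _ => by omega
  omega

/-- The largest element of a set of size $j+1$ is at least $j$; remove it and induct. -/
lemma sum_range_card_le_sum {w : ℕ → ℕ} (hw : Monotone w) (S : Finset ℕ) :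
    ∑ i ∈ Finset.range S.card, w i ≤ ∑ i ∈ S, w i := by
  induction S using Finset.induction_on_max with
  | empty => simp
  | insert m S hm ih =>
    have h0 : m ∉ S := fun h => (hm m h).false
    rw [Finset.card_insert_of_notMem h0, Finset.sum_insert h0, Finset.sum_range_succ, add_comm]
    refine add_le_add (hw ?_) ih
    have : S ⊆ Finset.range m := fun i hi => Finset.mem_range.2 (hm i hi)
    simpa using Finset.card_le_card this

lemma coeff_det_pencil_mem_pow {I : Ideal R} {a b : ℕ → ℕ} {P : ℕ → ℕ → R}
    (hP : ∀ m n, P m n ∈ I ^ (a m - b n)) (hab : ∀ n, b n ≤ a n)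
    (hw : Monotone fun i => a i - b i) {n : ℕ} (d : Fin n → R) (j : ℕ) :
    PowerSeries.coeff j (pencil d fun i k => P i k).det ∈
      I ^ ∑ i ∈ Finset.range j, (a i - b i) := by
  refine coeff_det_pencil_mem _ _ _ _ fun S σ hS _ hσ => ?_
  refine Ideal.pow_le_pow_right ?_ (prod_mem_pow_sum hP hab S σ hσ)
  have h := sum_range_card_le_sum hw (S.map Fin.valEmbedding)
  rwa [Finset.card_map, hS, Finset.sum_map] at h

/-- A zero last diagonal entry forces the last index into `S`, so its weight always contributes. -/
lemma coeff_det_pencil_mem_pow_last {I : Ideal R} {a b : ℕ → ℕ} {P : ℕ → ℕ → R}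
    (hP : ∀ m n, P m n ∈ I ^ (a m - b n)) (hab : ∀ n, b n ≤ a n) {n : ℕ} (d : Fin (n + 1) → R)
    (hd : d (Fin.last n) = 0) (j : ℕ) :
    PowerSeries.coeff j (pencil d fun i k => P i k).det ∈ I ^ (a n - b n) := by
  refine coeff_det_pencil_mem _ _ _ _ fun S σ _ hd' hσ => ?_
  refine Ideal.pow_le_pow_right ?_ (prod_mem_pow_sum hP hab S σ hσ)
  have h : Fin.last n ∈ S := by
    by_contra h
    exact hd' _ h hd
  exact Finset.single_le_sum (f := fun i : Fin (n + 1) => a i - b i) (fun _ _ => Nat.zero_le _) h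

/-- Linearity in the last row, splitting its diagonal $1$ off as a unit vector. That part returns
the smaller determinant, so the other measures the change from $n$ to $n+1$. -/
lemma det_pencil_succ (P : ℕ → ℕ → R) (n : ℕ) :
    (pencil (fun _ : Fin (n + 1) => (1 : R)) fun i k => P i k).det =
      (pencil (Function.update (fun _ : Fin (n + 1) => (1 : R)) (Fin.last n) 0)
        fun i k => P i k).det + (pencil (fun _ : Fin n => (1 : R)) fun i k => P i k).det := by
  set M := pencil (fun _ : Fin (n + 1) => (1 : R)) fun i k => P i k with hM
  set M' := pencil (Function.update (fun _ : Fin (n + 1) => (1 : R)) (Fin.last n) 0)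
        fun i k => P i k with hM'
  have h1 : M = M.updateRow (Fin.last n) (M' (Fin.last n) + Pi.single (Fin.last n) 1) := by
    ext1 i k
    rw [Matrix.updateRow_apply]
    split_ifs with hi
    · subst hi
      rw [Pi.add_apply, hM, hM', pencil, pencil, Matrix.of_apply, Matrix.of_apply]
      by_cases hk : k = Fin.last n
      · subst hk
        simp
        ring
      · simp [Ne.symm hk, hk]
    · rfl
  have h2 : M.updateRow (Fin.last n) (M' (Fin.last n)) = M' := by
    ext1 i k
    rw [Matrix.updateRow_apply]
    split_ifs with hi
    · rw [hi]
    · rw [hM, hM', pencil, pencil, Matrix.of_apply, Matrix.of_apply]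
      by_cases hk : i = k
      · subst hk
        simp [Function.update_of_ne hi]
      · simp [hk]
  have h3 : (M.updateRow (Fin.last n) (Pi.single (Fin.last n) 1)).det =
      (pencil (fun _ : Fin n => (1 : R)) fun i k => P i k).det := by
    rw [← Matrix.adjugate_apply, Matrix.adjugate_fin_succ_eq_det_submatrix]
    rw [Even.neg_one_pow ⟨_, rfl⟩, one_mul]
    congr 1
    ext1 i k
    simp [hM, pencil]
  conv_lhs => rw [h1, Matrix.det_updateRow_add, h2, h3]

end Determinants

/-! ### The characteristic power series -/

section CharSeries

open Filter Topology

/-- Finitely many generators are needed to collect the infinitely many coefficient expressions into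
one finite combination of series. -/
lemma mem_map_C_of_forall_coeff_mem {R : Type*} [CommRing R] {I : Ideal R} (hI : I.FG)
    {f : PowerSeries R} (hf : ∀ j, PowerSeries.coeff j f ∈ I) :
    f ∈ I.map (PowerSeries.C : R →+* PowerSeries R) := by
  obtain ⟨s, rfl⟩ := hI
  have h1 : ∀ j, ∃ c : R → R, ∑ a ∈ s, c a • a = PowerSeries.coeff j f := fun j => by
    obtain ⟨c, -, hc⟩ := Submodule.mem_span_finset.1 (hf j)
    exact ⟨c, hc⟩
  choose c hc using h1
  have h2 : f = ∑ a ∈ s, PowerSeries.mk (fun j => c j a) * PowerSeries.C a := by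
    ext j
    rw [map_sum, ← hc j]
    refine Finset.sum_congr rfl fun a _ => ?_
    rw [PowerSeries.coeff_mul_C, PowerSeries.coeff_mk, smul_eq_mul]
  rw [h2]
  exact Ideal.sum_mem _ fun a ha =>
    Ideal.mul_mem_left _ _ (Ideal.mem_map_of_mem _ (Ideal.subset_span ha))

lemma coeff_mem_of_mem_map_C {R : Type*} [CommRing R] {I : Ideal R} {f : PowerSeries R}
    (hf : f ∈ I.map (PowerSeries.C : R →+* PowerSeries R)) (j : ℕ) :
    PowerSeries.coeff j f ∈ I := by
  induction hf using Submodule.span_induction generalizing j with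
  | mem _ h =>
    obtain ⟨a, ha, rfl⟩ := h
    rw [PowerSeries.coeff_C]
    split_ifs
    · exact ha
    · exact I.zero_mem
  | zero =>
    rw [map_zero]
    exact I.zero_mem
  | add x y _ _ hx hy =>
    rw [map_add]
    exact I.add_mem (hx j) (hy j)
  | smul g x _ hx =>
    rw [smul_eq_mul, PowerSeries.coeff_mul]
    exact I.sum_mem fun i _ => I.mul_mem_left _ (hx _)

lemma tendsto_adic_iff {R : Type*} [CommRing R] (I : Ideal R) {u : ℕ → R} {a : R} :
    Tendsto u atTop (@nhds _ I.adicTopology a) ↔ ∀ k, ∀ᶠ n in atTop, u n - a ∈ I ^ k := by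
  rw [(I.hasBasis_nhds_adic a).tendsto_right_iff]
  simp only [true_imp_iff, Set.mem_image, SetLike.mem_coe]
  refine forall_congr' fun k => iff_of_eq (congrArg (fun P : ℕ → Prop => ∀ᶠ n in atTop, P n) ?_)
  funext n
  exact propext ⟨fun ⟨y, hy, h⟩ => by rwa [← h, add_sub_cancel_left], fun h => ⟨_, h, by ring⟩⟩

lemma div_mul_le_div (p t n : ℕ) : n / (p * t) ≤ n / t := by
  rw [mul_comm, ← Nat.div_div_eq_div_mul]
  exact Nat.div_le_self _ _

variable {p : ℕ} [Fact p.Prime]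

lemma mem_map_mLambda_pow_iff {f : PowerSeries (Iwasawa p)} {k : ℕ} :
    f ∈ (mLambda p).map (PowerSeries.C : Iwasawa p →+* PowerSeries (Iwasawa p)) ^ k ↔
      ∀ j, PowerSeries.coeff j f ∈ mLambda p ^ k := by
  rw [← Ideal.map_pow]
  classical
  refine ⟨coeff_mem_of_mem_map_C, mem_map_C_of_forall_coeff_mem (Ideal.FG.pow ?_)⟩
  exact ⟨{(p : Iwasawa p), T p}, by rw [mLambda, Finset.coe_insert, Finset.coe_singleton]⟩

/-- Convergence in the $\mathfrak m_\Lambda$-adic topology of $\Lambda[[X]]$ is coefficientwise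
convergence, uniform in the degree `j`. -/
lemma isCharSeries_iff {P : ℕ → ℕ → Iwasawa p} {F : PowerSeries (Iwasawa p)} :
    IsCharSeries P F ↔ ∀ k, ∀ᶠ n in atTop, ∀ j,
      PowerSeries.coeff j (minorChar P n) - PowerSeries.coeff j F ∈ mLambda p ^ k := by
  rw [IsCharSeries, tendsto_adic_iff]
  simp only [mem_map_mLambda_pow_iff, map_sub]

lemma minorChar_eq (P : ℕ → ℕ → Iwasawa p) (n : ℕ) :
    minorChar P n = (pencil (fun _ : Fin n => (1 : Iwasawa p)) fun i k => P i k).det := by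
  rw [minorChar]
  congr 1
  ext1 i k
  rw [pencil, Matrix.of_apply, Matrix.sub_apply, Matrix.smul_apply, Matrix.of_apply, smul_eq_mul,
    Matrix.one_apply]
  split_ifs <;> simp

lemma monotone_weight (t : ℕ) : Monotone fun i => i / t - i / (p * t) := by
  have h1 : Monotone fun k : ℕ => k - k / p := by
    refine monotone_nat_of_le_succ fun k => ?_
    have h2 : (k + 1) / p ≤ k / p + 1 := by
      rw [Nat.succ_div]
      split_ifs <;> omega
    have h3 : k / p ≤ k := Nat.div_le_self k p
    change k - k / p ≤ k + 1 - (k + 1) / p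
    omega
  intro i j hij
  simp only [mul_comm p t, ← Nat.div_div_eq_div_mul]
  exact h1 (Nat.div_le_div_right hij)

/-- The factor $2$ comes from $p\ge2$: $k-\lfloor k/p\rfloor\ge k/2$. -/
lemma le_weight {t : ℕ} (ht : 0 < t) (K : ℕ) :
    ∀ n, 2 * K * t ≤ n → K ≤ n / t - n / (p * t) := by
  have hp : p.Prime := Fact.out
  intro n hn
  rw [mul_comm p t, ← Nat.div_div_eq_div_mul]
  have h1 : 2 * K ≤ n / t := (Nat.le_div_iff_mul_le ht).2 hn
  have h2 : n / t / p ≤ n / t / 2 := Nat.div_le_div_left hp.two_le (by norm_num)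
  omega

variable {t : ℕ} {P : ℕ → ℕ → Iwasawa p}

lemma coeff_minorChar_mem (hP : ∀ m n, P m n ∈ mLambda p ^ (m / t - n / (p * t))) (n j : ℕ) :
    PowerSeries.coeff j (minorChar P n) ∈ mLambda p ^ lam p t j := by
  rw [minorChar_eq]
  exact coeff_det_pencil_mem_pow hP (div_mul_le_div p t) (monotone_weight t) _ j

lemma coeff_minorChar_sub_mem (ht : 0 < t)
    (hP : ∀ m n, P m n ∈ mLambda p ^ (m / t - n / (p * t))) (K j : ℕ) {n n' : ℕ}
    (hn : 2 * K * t ≤ n) (hn' : n ≤ n') :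
    PowerSeries.coeff j (minorChar P n') - PowerSeries.coeff j (minorChar P n) ∈
      mLambda p ^ K := by
  induction n', hn' using Nat.le_induction with
  | base =>
    rw [sub_self]
    exact zero_mem _
  | succ n' h ih =>
    have h1 := coeff_det_pencil_mem_pow_last hP (div_mul_le_div p t)
      (Function.update (fun _ : Fin (n' + 1) => (1 : Iwasawa p)) (Fin.last n') 0)
      (Function.update_self ..) j
    rw [minorChar_eq P (n' + 1), det_pencil_succ, ← minorChar_eq, map_add, add_sub_assoc]
    exact Ideal.add_mem _ (Ideal.pow_le_pow_right (le_weight ht K n' (hn.trans h)) h1) ih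

theorem existsUnique_isCharSeries (ht : 0 < t)
    (hP : ∀ m n, P m n ∈ mLambda p ^ (m / t - n / (p * t))) :
    ∃! F : PowerSeries (Iwasawa p), IsCharSeries P F := by
  have h1 : ∀ j, ∃ a, Tendsto (fun n => PowerSeries.coeff j (minorChar P n)) atTop (𝓝 a) := by
    intro j
    refine exists_limit_of_sub_mem _ (tendsto_iwasawa_iff.2 fun k => ?_)
    filter_upwards [eventually_ge_atTop (2 * k * t)] with n hn
    rw [sub_zero]
    exact coeff_minorChar_sub_mem ht hP k j hn (Nat.le_succ n)
  choose c hc using h1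
  refine ⟨PowerSeries.mk c, isCharSeries_iff.2 fun k => ?_, fun F hF => ?_⟩
  · filter_upwards [eventually_ge_atTop (2 * k * t)] with n hn j
    -- The bound between two truncations does not depend on `j` and passes to the limit because
    -- powers of $\mathfrak m_\Lambda$ are closed.
    rw [PowerSeries.coeff_mk, ← neg_mem_iff, neg_sub]
    refine (isClosed_mLambda_pow k).mem_of_tendsto ((hc j).sub_const _) ?_
    filter_upwards [eventually_ge_atTop n] with n' hn'
    exact coeff_minorChar_sub_mem ht hP k j hn hn'
  · ext j
    rw [PowerSeries.coeff_mk]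
    refine tendsto_nhds_unique (tendsto_iwasawa_iff.2 fun k => ?_) (hc j)
    filter_upwards [isCharSeries_iff.1 hF k] with n hn
    exact hn j

lemma IsCharSeries.coeff_mem (hP : ∀ m n, P m n ∈ mLambda p ^ (m / t - n / (p * t)))
    {F : PowerSeries (Iwasawa p)} (hF : IsCharSeries P F) (j : ℕ) :
    PowerSeries.coeff j F ∈ mLambda p ^ lam p t j := by
  obtain ⟨n, hn⟩ := (isCharSeries_iff.1 hF (lam p t j)).exists
  have h := Ideal.sub_mem _ (coeff_minorChar_mem hP n j) (hn j)
  rwa [sub_sub_cancel] at h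

lemma toLambdaGt_mem {x : Iwasawa p} {k : ℕ} (hx : x ∈ mLambda p ^ k) :
    toLambdaGt p x ∈ Ideal.span {toLambdaGt p (T p) ^ k} := by
  have h1 : (mLambda p).map (toLambdaGt p) ≤ Ideal.span {toLambdaGt p (T p)} := by
    rw [mLambda, Ideal.map_span, Ideal.span_le]
    rintro _ ⟨_, rfl | rfl, rfl⟩
    · rw [SetLike.mem_coe, Ideal.mem_span_singleton]
      -- The cofactor is $Y=pT^{-1}$, by the defining relation $TY=p$.
      refine ⟨Ideal.Quotient.mk _ PowerSeries.X, ?_⟩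
      rw [map_natCast]
      have h2 : Ideal.Quotient.mk
          (Ideal.span {PowerSeries.C (T p) * PowerSeries.X - (p : PowerSeries (Iwasawa p))})
          (PowerSeries.C (T p) * PowerSeries.X - (p : PowerSeries (Iwasawa p))) = 0 :=
        Ideal.Quotient.eq_zero_iff_mem.2 (Ideal.subset_span rfl)
      rw [map_sub, map_mul, map_natCast, sub_eq_zero] at h2
      exact h2.symm
    · exact Ideal.subset_span rfl
  rw [← Ideal.span_singleton_pow]
  refine Ideal.pow_right_mono h1 k ?_
  rw [← Ideal.map_pow]
  exact Ideal.mem_map_of_mem _ hx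

end CharSeries

end IntegralForms

end

open IntegralForms in
theorem theorem3p10 (p : ℕ) [Fact p.Prime]
    (D : Type*) [Ring D] [Algebra ℚ D] (hD : IsDefiniteQuaternion D)
    (ι : TensorProduct ℚ ℚ_[p] D ≃ₐ[ℚ_[p]] Matrix (Fin 2) (Fin 2) ℚ_[p])
    (Kp : Subgroup (TameGroup p D)) (hopen : IsOpen (Kp : Set (TameGroup p D)))
    (hcompact : IsCompact (Kp : Set (TameGroup p D))) (hneat : IsNeat ι Kp)
    (t : ℕ) (γ : Fin t → FinGroup p D) (hγ : IsRepresentatives ι Kp γ) :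
    (∃! e : ℕ → FinGroup p D → ℤ_[p] → Iwasawa p, IsMahlerBasis ι Kp γ e) ∧
    ∀ e : ℕ → FinGroup p D → ℤ_[p] → Iwasawa p, IsMahlerBasis ι Kp γ e →
      (∃! P : ℕ → ℕ → Iwasawa p, IsMatrixOfUp e P) ∧
      ∀ P : ℕ → ℕ → Iwasawa p, IsMatrixOfUp e P →
        (∃! F : PowerSeries (Iwasawa p), IsCharSeries P F) ∧
        ∀ F : PowerSeries (Iwasawa p), IsCharSeries P F →
          ∀ n : ℕ, toLambdaGt p (PowerSeries.coeff n F) ∈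
            Ideal.span {toLambdaGt p (T p) ^ lam p t n} :=
  ⟨existsUnique_isMahlerBasis hγ hneat, fun _ he =>
    ⟨existsUnique_isMatrixOfUp hγ he, fun _ hP =>
      ⟨existsUnique_isCharSeries hγ.pos (hP.mem hγ he), fun _ hF n =>
        toLambdaGt_mem (hF.coeff_mem (hP.mem hγ he) n)⟩⟩⟩
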